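/- Let $n\ge 1$, $\beta>0$, and let $h(x)=e^{-\beta|x|^2}$ be the Gaussian on $\mathbb R^n$ ($|\cdot|$ the Euclidean norm). Let $\mathcal C_h$ be the space of continuous $f:\mathbb R^n\to\mathbb C$ for which there is a constant $c\ge 0$ with $$\Big|\int f(x)\varphi(x)\,dx\Big|\le c\,\Big\{\iint h(x-y)\varphi(x)\overline{\varphi(y)}\,dx\,dy\Big\}^{1/2}$$ for all compactly supported $C^\infty$ functions $\varphi:\mathbb R^n\to\mathbb C$, and let $\|f\|_h$ be the smallest such $c$. For $X\subseteq\mathbb R^n$ and $f\in\mathcal C_h$, an $h$-spline interpolating $f$ on $X$ is an element $s\in\mathcal C_h$ of minimal norm $\|s\|_h$ among those that equal $f$ on $X$, or, if $X=\{x_1,\dots,x_N\}$ is finite, a function $s(x)=\sum_{j}c_jh(x-x_j)$ with complex $c_j$ that equals $f$ on $X$. Let $\gamma_1=2$ and $\gamma_n=2n(1+\gamma_{n-1})$ for $n>1$; let $\rho=\sqrt3/e$ and let $\alpha_n$ be the volume of the unit ball of $\mathbb R^n$. Put $$\Delta''=\begin{cases}\pi^{\frac{n-1}4}(n\alpha_n)^{\frac12}\,2^{\frac{n+1}4}\big(\tfrac{\sqrt3}e\big)^{\frac{n-2}4},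 & n\text{ even},\\ \pi^{\frac{n-1}4}(n\alpha_n)^{\frac12}\big(2+\tfrac1e\big)^{\frac12}2^{\frac n4}\big(\tfrac{\sqrt3}e\big)^{\frac{n-1}4}, & n\text{ odd}.\end{cases}$$ Given $b_0>0$, put $$c=\frac{b_0}{8\gamma_n},\qquad C=\Big(3^{3/4}\,e\,\sqrt{2\rho\beta}\,\sqrt n\,e^{2n\gamma_n}\Big)^4 b_0^3\gamma_n,\qquad \delta_0=\min\{1/C,\ \delta_n\},$$ where $\delta_n=\frac{b_0}{2\gamma_n}$ if $n\in\{1,2\}$, $\delta_n=\frac{b_0}{2\gamma_n(n-1)}$ if $n>1$ is odd, and $\delta_n=\frac{b_0}{2\gamma_n(n-2)}$ if $n>2$ is even. **Theorem 1.** The constants $\delta_0,c,C$ are positive, and if $f\in\mathcal C_h$ and $s$ is an $h$-spline interpolating $f$ on a subset $X$ of $\mathbb R^n$, then $$|f(x)-s(x)|\le\Delta''\,(C\delta)^{c/\delta}\,\|f\|_h$$ for all $x$ in a closed cube $E\subset\mathbb R^n$ (of arbitrary orientation), provided that (i) $E$ has side $b\ge b_0$, (ii) $0<\delta\le\delta_0$,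 and (iii) every closed subcube of $E$ of side $\delta$ with edges parallel to those of $E$ contains a point of $X$. -/

import Mathlib

open MeasureTheory
open scoped ContDiff ComplexConjugate

/-- Euclidean space `ℝⁿ` with its Euclidean norm. -/
abbrev RSpace (n : ℕ) : Type := EuclideanSpace ℝ (Fin n)

noncomputable section

/-- The Gaussian `h(x) = exp (-β |x|²)` on `ℝⁿ`, as a complex-valued function. -/
def gaussianFn (n : ℕ) (β : ℝ) (x : RSpace n) : ℂ :=
  ((Real.exp (-β * ‖x‖ ^ 2) : ℝ) : ℂ)

/-- The class `𝒟_m`: complex-valued, smooth, compactly supported functions on `ℝⁿ` whose moments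
of order `< m` vanish.  For `m = 0` these are all test functions. -/
def IsTestFn {n : ℕ} (m : ℕ) (φ : RSpace n → ℂ) : Prop :=
  ContDiff ℝ ∞ φ ∧ HasCompactSupport φ ∧
    ∀ a : Fin n → ℕ, ∑ i, a i < m → ∫ x, ((∏ i, x i ^ a i : ℝ) : ℂ) * φ x = 0

/-- The quadratic form `∬ h(x - y) φ(x) conj φ(y) dx dy` (a nonnegative real number for `φ ∈ 𝒟_m`
if `h` is conditionally positive definite of order `m`). -/
def energy {n : ℕ} (h φ : RSpace n → ℂ) : ℝ :=
  (∫ x, ∫ y, h (x - y) * φ x * conj (φ y)).re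

/-- `c ≥ 0` is an admissible constant for `f`:
`|∫ f φ| ≤ c (∬ h(x - y) φ(x) conj φ(y) dx dy)^{1/2}` for all `φ ∈ 𝒟_m`. -/
def IsNativeBound {n : ℕ} (h : RSpace n → ℂ) (m : ℕ) (f : RSpace n → ℂ) (c : ℝ) : Prop :=
  0 ≤ c ∧ ∀ φ : RSpace n → ℂ, IsTestFn m φ → ‖∫ x, f x * φ x‖ ≤ c * √(energy h φ)

/-- The native space `𝒞_{h,m}`: the continuous functions that have an admissible constant. -/
def nativeSpace {n : ℕ} (h : RSpace n → ℂ) (m : ℕ) : Set (RSpace n → ℂ) :=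
  {f | Continuous f ∧ ∃ c, IsNativeBound h m f c}

/-- `‖f‖_h`, the smallest admissible constant of `f ∈ 𝒞_{h,m}`. -/
def nativeNorm {n : ℕ} (h : RSpace n → ℂ) (m : ℕ) (f : RSpace n → ℂ) : ℝ :=
  sInf {c | IsNativeBound h m f c}

/-- `s` is an element of `𝒞_{h,m}` of minimal norm among those that agree with `f` on `X`
(`X` an arbitrary subset of `ℝⁿ`). -/
def IsMinNormInterpolant {n : ℕ} (h : RSpace n → ℂ) (m : ℕ) (f : RSpace n → ℂ)
    (X : Set (RSpace n)) (s : RSpace n → ℂ) : Prop :=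
  s ∈ nativeSpace h m ∧ Set.EqOn s f X ∧
    ∀ g ∈ nativeSpace h m, Set.EqOn g f X → nativeNorm h m s ≤ nativeNorm h m g

/-- The polynomials on `ℝⁿ` of degree `≤ m - 1` (only `0` if `m = 0`). -/
def IsLowDegree {n : ℕ} (m : ℕ) (p : MvPolynomial (Fin n) ℂ) : Prop :=
  ∀ d ∈ p.support, ∑ i, d i < m

/-- The value at `x ∈ ℝⁿ` of a polynomial. -/
def polyEval {n : ℕ} (p : MvPolynomial (Fin n) ℂ) (x : RSpace n) : ℂ :=
  MvPolynomial.eval (fun i => (x i : ℂ)) p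

/-- `X` is finite and `s(x) = p(x) + ∑_{y ∈ X} c_y h(x - y)` with `p` of degree `≤ m - 1`,
`∑_{y ∈ X} c_y q(y) = 0` for all `q` of degree `≤ m - 1`, and `s = f` on `X`. -/
def IsFiniteSplineInterpolant {n : ℕ} (h : RSpace n → ℂ) (m : ℕ) (f : RSpace n → ℂ)
    (X : Set (RSpace n)) (s : RSpace n → ℂ) : Prop :=
  ∃ (N : Finset (RSpace n)) (p : MvPolynomial (Fin n) ℂ) (c : RSpace n → ℂ),
    (N : Set (RSpace n)) = X ∧ IsLowDegree m p ∧
    (∀ q : MvPolynomial (Fin n) ℂ, IsLowDegree m q → ∑ y ∈ N, c y * polyEval q y = 0) ∧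
    (∀ x, s x = polyEval p x + ∑ y ∈ N, c y * h (x - y)) ∧
    Set.EqOn s f X

/-- `s` is an `h`-spline that interpolates `f` on `X`, under either of the two usual descriptions:
the minimal norm interpolant (for any `X`), or the solution of the interpolation system
(for finite `X`). -/
def IsSplineInterpolant {n : ℕ} (h : RSpace n → ℂ) (m : ℕ) (f : RSpace n → ℂ)
    (X : Set (RSpace n)) (s : RSpace n → ℂ) : Prop :=
  IsMinNormInterpolant h m f X s ∨ IsFiniteSplineInterpolant h m f X s

/-- The closed cube of side `b` with corner `a` and edges along the orthonormal basis `u`. -/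
def cube {n : ℕ} (u : OrthonormalBasis (Fin n) ℝ (RSpace n)) (a : RSpace n) (b : ℝ) :
    Set (RSpace n) :=
  {x | ∀ i, inner ℝ (u i) (x - a) ∈ Set.Icc 0 b}

/-- `γ₁ = 2` and `γₙ = 2n (1 + γₙ₋₁)` for `n > 1` (the value at `0` is irrelevant). -/
def gammaSeq : ℕ → ℕ
  | 0 => 0
  | 1 => 2
  | n + 2 => 2 * (n + 2) * (1 + gammaSeq (n + 1))

/-- `ρ = √3 / e`. -/
def rhoConst : ℝ := √3 / Real.exp 1

/-- `αₙ`, the volume of the unit ball of `ℝⁿ`. -/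
def ballVolume (n : ℕ) : ℝ := (volume (Metric.ball (0 : RSpace n) 1)).toReal

/-- `Δ''`. -/
def deltaConst (n : ℕ) : ℝ :=
  if Even n then
    Real.pi ^ (((n : ℝ) - 1) / 4) * (n * ballVolume n) ^ ((1 : ℝ) / 2)
      * 2 ^ (((n : ℝ) + 1) / 4) * (√3 / Real.exp 1) ^ (((n : ℝ) - 2) / 4)
  else
    Real.pi ^ (((n : ℝ) - 1) / 4) * (n * ballVolume n) ^ ((1 : ℝ) / 2)
      * (2 + 1 / Real.exp 1) ^ ((1 : ℝ) / 2)
      * 2 ^ ((n : ℝ) / 4) * (√3 / Real.exp 1) ^ (((n : ℝ) - 1) / 4)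

/-- `c = b₀ / (8 γₙ)`. -/
def smallC (n : ℕ) (b₀ : ℝ) : ℝ := b₀ / (8 * gammaSeq n)

/-- `C = (3^{3/4} e √(2ρβ) √n e^{2nγₙ})⁴ b₀³ γₙ`. -/
def bigC (n : ℕ) (β b₀ : ℝ) : ℝ :=
  ((3 : ℝ) ^ ((3 : ℝ) / 4) * Real.exp 1 * √(2 * rhoConst * β) * √(n : ℝ)
    * Real.exp (2 * n * gammaSeq n)) ^ 4 * b₀ ^ 3 * gammaSeq n

/-- `δₙ`: `b₀ / (2γₙ)` for `n = 1, 2`, `b₀ / (2γₙ(n-1))` for odd `n > 1`, and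
`b₀ / (2γₙ(n-2))` for even `n > 2`. -/
def deltaN (n : ℕ) (b₀ : ℝ) : ℝ :=
  if n = 1 ∨ n = 2 then b₀ / (2 * gammaSeq n)
  else if Odd n then b₀ / (2 * gammaSeq n * ((n : ℝ) - 1))
  else b₀ / (2 * gammaSeq n * ((n : ℝ) - 2))

/-- `δ₀ = min {1 / ((3^{3/4} e √(2ρβ) √n e^{2nγₙ})⁴ b₀³ γₙ), δₙ}`. -/
def deltaZero (n : ℕ) (β b₀ : ℝ) : ℝ :=
  min (1 / (((3 : ℝ) ^ ((3 : ℝ) / 4) * Real.exp 1 * √(2 * rhoConst * β) * √(n : ℝ)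
    * Real.exp (2 * n * gammaSeq n)) ^ 4 * b₀ ^ 3 * gammaSeq n)) (deltaN n b₀)

end

/-! The error is tested with a finite combination of point masses: mass 1 at `x` and weights at
points of `X`. The masses on `X` cancel because `s = f` there, so `f x - s x` is the pairing of the
combination with `f` minus its pairing with `s`. Each pairing is at most `‖f‖_h` times the square
root of the Gaussian energy of the combination. For `f` this is the definition of the norm, extended
from test functions to point masses by mollification. For `s` it is minimality or, for a finite
kernel sum, Cauchy–Schwarz for the Gaussian form. It remains to find a combination of small energy.

With positions `u` relative to `x`, the kernel factors as `exp(-b|u-u'|²) = exp(-b|u|²) exp(-b|u'|²)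
exp(2b u·u')`. Weights `μ exp(b|u|²)` remove the first two factors. If `μ` annihilates polynomials
of degree `< k`, the Taylor polynomial of the third drops out as well, and the energy is at most
`(∑|σ|)²` times a Taylor remainder of size `2 t^k / k!`, where `-σ` is the part of `μ` on `X`
(`exists_gaussian_weights`).

Such a `μ` amounts to a representation of evaluation at `x`, on polynomials of degree `< k`, by
point values with coefficients `σ` of small ℓ¹ norm. By Hahn–Banach (`exists_weights_of_abs_le`)
this is dual to a norming inequality: on a cube cut into `(γₙ k)ⁿ` cells, a polynomial of degree `<
k` is at most `e^{2nγₙk}` times its maximum over one point per cell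
(`abs_eval_le_exp_mul_of_cells`).

The norming inequality goes by induction on dimension (`abs_eval_le_of_many_hits`). Call a cell hit
if `|p| ≤ M` somewhere in it. Either `d + 1` parallel grid hyperplanes contain many hit cells, and
induction on them followed by Lagrange interpolation across them bounds `p`; or there are too few
hits altogether, because a hit cell either has a hit face or encloses a critical point of a
perturbation of `p²`, and a Bézout-type count limits the latter. Finally `k` is taken of order `b₀ /
(γₙ δ)` (`exists_degree`). -/

/-! ### Lagrange interpolation at separated nodes. -/

theorem prod_erase_range_abs_sub (i m : ℕ) :
    ∏ j ∈ (Finset.range (i + m + 1)).erase i, |(i : ℝ) - j| = i.factorial * m.factorial := by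
  induction m with
  | zero =>
    have h : (Finset.range (i + 0 + 1)).erase i = Finset.range i := by
      ext j; simp; omega
    rw [h, ← Finset.prod_range_reflect, ← Finset.prod_range_add_one_eq_factorial]
    push_cast
    simp only [Nat.factorial_zero, Nat.cast_one, mul_one]
    refine Finset.prod_congr rfl fun j hj => ?_
    have hj := Finset.mem_range.1 hj
    rw [Nat.sub_sub, Nat.cast_sub (by omega)]
    push_cast
    rw [abs_of_nonneg (by linarith [j.cast_nonneg (α := ℝ)])]
    ring
  | succ m ih =>
    have h : (Finset.range (i + (m + 1) + 1)).erase i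
        = insert (i + m + 1) ((Finset.range (i + m + 1)).erase i) := by
      ext j; simp; omega
    rw [h, Finset.prod_insert (by simp), ih, Nat.factorial_succ]
    push_cast
    rw [abs_of_nonpos (by linarith [m.cast_nonneg (α := ℝ)])]
    ring

/-- Lagrange interpolation at points of `[0, Q]` that are separated like integers. -/
theorem Polynomial.abs_eval_le_of_separated {d : ℕ} {p : Polynomial ℝ} (hp : p.natDegree ≤ d)
    {y : ℕ → ℝ} {Q M : ℝ} (hy : ∀ i ≤ d, y i ∈ Set.Icc 0 Q)
    (hsep : ∀ i j, i < j → j ≤ d → ((j : ℝ) - i) ≤ y j - y i)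
    (hM : ∀ i ≤ d, |p.eval (y i)| ≤ M) {x : ℝ} (hx : x ∈ Set.Icc 0 Q) :
    |p.eval x| ≤ (2 * Q) ^ d / d.factorial * M := by
  have hQ : 0 ≤ Q := hx.1.trans hx.2
  -- Comparison with integer nodes: each Lagrange basis polynomial has numerator at most `Q ^ d` and
  -- denominator at least `i! (d-i)!`. Summing the resulting binomial coefficients gives `2 ^ d`.
  have hsep' : ∀ i ≤ d, ∀ j ≤ d, |(i : ℝ) - j| ≤ |y i - y j| := by
    intro i hi j hj
    rcases lt_trichotomy i j with h | h | h
    · have := hsep i j h hj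
      have h' : (i : ℝ) < j := by exact_mod_cast h
      rw [abs_sub_comm, abs_of_pos (by linarith), abs_sub_comm (y i)]
      exact this.trans (le_abs_self _)
    · simp [h]
    · have := hsep j i h hi
      have h' : (j : ℝ) < i := by exact_mod_cast h
      rw [abs_of_pos (by linarith)]
      exact this.trans (le_abs_self _)
  have hinj : Set.InjOn y (Finset.range (d + 1) : Set ℕ) := by
    intro i hi j hj hij
    have hi' : i ≤ d := by simpa [Nat.lt_succ_iff] using hi
    have hj' : j ≤ d := by simpa [Nat.lt_succ_iff] using hj
    have := hsep' i hi' j hj'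
    rw [hij, sub_self, abs_zero] at this
    have := abs_nonpos_iff.1 this
    exact_mod_cast sub_eq_zero.1 this
  have hdeg : p.degree < (Finset.range (d + 1)).card := by
    rw [Finset.card_range]
    refine (Polynomial.degree_le_of_natDegree_le hp).trans_lt ?_
    exact_mod_cast Nat.lt_succ_self d
  rw [Lagrange.eq_interpolate hinj hdeg, Lagrange.interpolate_apply, Polynomial.eval_finsetSum]
  have hbasis : ∀ i ∈ Finset.range (d + 1),
      |(Polynomial.C (p.eval (y i)) * Lagrange.basis (Finset.range (d + 1)) y i).eval x|
        ≤ M * (Q ^ d / d.factorial * (d.choose i)) := by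
    intro i hi
    have hid : i ≤ d := by simpa [Nat.lt_succ_iff] using hi
    rw [Polynomial.eval_mul, Polynomial.eval_C, abs_mul]
    have hM0 : 0 ≤ M := (abs_nonneg _).trans (hM i hid)
    refine mul_le_mul (hM i hid) ?_ (abs_nonneg _) hM0
    have hcard : ((Finset.range (d + 1)).erase i).card = d := by
      rw [Finset.card_erase_of_mem hi, Finset.card_range]; simp
    calc |(Lagrange.basis (Finset.range (d + 1)) y i).eval x|
        = ∏ j ∈ (Finset.range (d + 1)).erase i, |x - y j| / |y i - y j| := by
          rw [Lagrange.basis, Polynomial.eval_prod, Finset.abs_prod]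
          refine Finset.prod_congr rfl fun j _ => ?_
          simp [Lagrange.basisDivisor, abs_mul, abs_inv, div_eq_inv_mul]
      _ ≤ ∏ j ∈ (Finset.range (d + 1)).erase i, Q / |(i : ℝ) - j| := by
          refine Finset.prod_le_prod (fun j _ => by positivity) fun j hj => ?_
          have hj' := Finset.mem_erase.1 hj
          have hjd : j ≤ d := by simpa [Nat.lt_succ_iff] using hj'.2
          have hpos : 0 < |(i : ℝ) - j| :=
            abs_pos.2 (sub_ne_zero.2 (by exact_mod_cast (Ne.symm hj'.1)))
          have h1 : |x - y j| ≤ Q := by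
            have := hy j hjd
            rw [abs_le]; constructor <;> linarith [hx.1, hx.2, this.1, this.2]
          exact div_le_div₀ hQ h1 hpos (hsep' i hid j hjd)
      _ = Q ^ d / (i.factorial * (d - i).factorial) := by
          rw [Finset.prod_div_distrib, Finset.prod_const, hcard]
          have := prod_erase_range_abs_sub i (d - i)
          rw [Nat.add_sub_cancel' hid] at this
          rw [this]
      _ = Q ^ d / d.factorial * (d.choose i) := by
          rw [Nat.cast_choose ℝ hid]
          field_simp
  refine (Finset.abs_sum_le_sum_abs _ _).trans ((Finset.sum_le_sum hbasis).trans_eq ?_)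
  rw [← Finset.mul_sum, ← Finset.mul_sum]
  have : ∑ i ∈ Finset.range (d + 1), (d.choose i : ℝ) = 2 ^ d := by
    exact_mod_cast Nat.sum_range_choose d
  rw [this, mul_pow]; ring

/-! ### A Bézout-type bound for the number of real zeros. -/

namespace MvPolynomial

theorem totalDegree_aeval_le_of_totalDegree_le_one {σ τ R : Type*} [CommSemiring R]
    (p : MvPolynomial σ R) (f : σ → MvPolynomial τ R) (hf : ∀ i, (f i).totalDegree ≤ 1) :
    (aeval f p).totalDegree ≤ p.totalDegree := by
  rw [aeval_def, eval₂]
  refine totalDegree_finsetSum_le fun a ha => ?_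
  refine (totalDegree_mul _ _).trans ?_
  rw [algebraMap_eq, totalDegree_C, zero_add]
  refine (totalDegree_finsetProd _ _).trans ((Finset.sum_le_sum fun i _ => ?_).trans
    (le_totalDegree ha))
  exact (totalDegree_pow _ _).trans ((Nat.mul_le_mul_left _ (hf i)).trans_eq (mul_one _))

theorem totalDegree_pderiv_lt {σ R : Type*} [CommSemiring R] (p : MvPolynomial σ R) (i : σ)
    {m : ℕ} (hp : p.totalDegree ≤ m) (hm : 0 < m) : (pderiv i p).totalDegree < m := by
  classical
  rw [totalDegree, Finset.sup_lt_iff hm]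
  intro a ha
  have hne : coeff (a + Finsupp.single i 1) p ≠ 0 := by
    intro h
    rw [mem_support_iff, coeff_pderiv, h, zero_mul] at ha
    exact ha rfl
  have h1 := (le_totalDegree (mem_support_iff.2 hne)).trans hp
  rw [Finsupp.sum_add_index' (fun _ => rfl) (fun _ _ _ => rfl), Finsupp.sum_single_index rfl] at h1
  exact h1

theorem hasDerivAt_eval_update {n : ℕ} (p : MvPolynomial (Fin n) ℝ) (i : Fin n)
    (z : Fin n → ℝ) (t : ℝ) :
    HasDerivAt (fun s => eval (Function.update z i s) p)
      (eval (Function.update z i t) (pderiv i p)) t := by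
  induction p using MvPolynomial.induction_on with
  | C a => simpa using hasDerivAt_const t a
  | add p q hp hq =>
    simp only [map_add]
    exact hp.add hq
  | mul_X p j hp =>
    have hX : HasDerivAt (fun s => Function.update z i s j)
        (eval (Function.update z i t) (pderiv i (X j : MvPolynomial (Fin n) ℝ))) t := by
      by_cases h : j = i
      · subst h; simpa using hasDerivAt_id' t
      · simpa [h, pderiv_X_of_ne h] using hasDerivAt_const t (z j)
    have := hp.mul hX
    simp only [pderiv_mul, map_add, map_mul, eval_X]
    exact this

/-- A system `e X_i ^ m + (lower order) = 0` in `n` unknowns has at most `m ^ n` solutions. -/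
theorem card_zeros_le_pow {n m : ℕ} {e : ℝ} (he : e ≠ 0) (f : Fin n → MvPolynomial (Fin n) ℝ)
    (hf : ∀ i, (f i).totalDegree < m) (Z : Finset (Fin n → ℝ))
    (hZ : ∀ z ∈ Z, ∀ i, e * z i ^ m + eval z (f i) = 0) : Z.card ≤ m ^ n := by
  classical
  let E : MvPolynomial (Fin n) ℝ →ₐ[ℝ] (Z → ℝ) := aeval fun i z => z.1 i
  have hE : ∀ p z, E p z = eval z.1 p := by
    intro p z
    have : ((Pi.evalAlgHom ℝ (fun _ : Z => ℝ) z).comp E) = aeval z.1 := by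
      ext i; simp [E]
    rw [← coe_aeval_eq_eval, ← this]; rfl
  -- The `m ^ n` monomials with all exponents below `m`. Their restrictions to `Z` turn out to span
  -- all functions on `Z`, which bounds `Z.card`.
  let b : (Fin n → Fin m) → (Z → ℝ) :=
    fun a => E (monomial (Finsupp.equivFunOnFinite.symm fun i => (a i : ℕ)) 1)
  let S := Submodule.span ℝ (Set.range b)
  have hmem : ∀ N, ∀ p : MvPolynomial (Fin n) ℝ, p.totalDegree ≤ N → E p ∈ S := by
    intro N
    induction N using Nat.strong_induction_on with
    | _ N ih =>
    intro p hp
    rw [p.as_sum, map_sum]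
    refine Submodule.sum_mem _ fun a ha => ?_
    by_cases hbox : ∀ i, a i < m
    · have : monomial a (coeff a p) = coeff a p • monomial a 1 := by
        rw [smul_monomial, smul_eq_mul, mul_one]
      rw [this, map_smul]
      refine Submodule.smul_mem _ _ (Submodule.subset_span ⟨fun i => ⟨a i, hbox i⟩, ?_⟩)
      have : (Finsupp.equivFunOnFinite.symm fun i => a i) = a := by ext; simp
      simp only [b, this]
    · push Not at hbox
      obtain ⟨i, hi⟩ := hbox
      have hle : Finsupp.single i m ≤ a := by
        rw [Finsupp.single_le_iff]; exact hi
      set a' := a - Finsupp.single i m with ha'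
      have haa : a' + Finsupp.single i m = a := tsub_add_cancel_of_le hle
      have hdeg : a'.sum (fun _ k => k) + m ≤ N := by
        have h1 := (le_totalDegree ha).trans hp
        rw [← haa, Finsupp.sum_add_index' (fun _ => rfl) (fun _ _ _ => rfl),
          Finsupp.sum_single_index rfl] at h1
        exact h1
      -- On `Z` the power `X i ^ m` equals `-f i / e`, which has smaller degree; this drives the
      -- induction.
      have heq : E (monomial a (coeff a p))
          = E (monomial a' (-(coeff a p / e)) * f i) := by
        funext z
        rw [hE, hE, ← haa, ← mul_one (coeff _ p), ← monomial_mul, map_mul, map_mul]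
        have := hZ z.1 z.2 i
        have hX : eval z.1 (monomial (Finsupp.single i m) (1 : ℝ)) = z.1 i ^ m := by
          simp [eval_monomial]
        rw [hX, eval_monomial, eval_monomial, haa]
        have h2 : z.1 i ^ m = - eval z.1 (f i) / e := by
          field_simp; linarith
        rw [h2]; ring
      rw [heq]
      have h3 := hf i
      refine ih (a'.sum (fun _ k => k) + (f i).totalDegree) (by omega) _ ?_
      exact (totalDegree_mul _ _).trans (Nat.add_le_add_right (totalDegree_monomial_le _ _) _)
  have htop : S = ⊤ := by
    rw [eq_top_iff]
    intro v _
    -- A product of squared distances to the other points: up to scaling, the indicator of `w` on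
    -- `Z`.
    let q : Z → MvPolynomial (Fin n) ℝ := fun w =>
      ∏ z ∈ Finset.univ.erase w, ∑ i, (X i - C (z.1 i)) ^ 2
    have hq0 : ∀ w z, z ≠ w → eval z.1 (q w) = 0 := by
      intro w z hzw
      rw [map_prod]
      refine Finset.prod_eq_zero (i := z) (by simp [hzw]) ?_
      simp
    have hq1 : ∀ w : Z, eval w.1 (q w) ≠ 0 := by
      intro w
      rw [map_prod]
      refine Finset.prod_ne_zero_iff.2 fun z hz h => ?_
      rw [map_sum, Finset.sum_eq_zero_iff_of_nonneg (fun i _ => by simp [sq_nonneg])] at h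
      apply (Finset.mem_erase.1 hz).1
      ext i
      have := h i (Finset.mem_univ _)
      simp at this
      linarith
    have : v = E (∑ w : Z, C (v w / eval w.1 (q w)) * q w) := by
      funext z
      rw [hE, map_sum, Finset.sum_eq_single z]
      · rw [map_mul, eval_C, div_mul_cancel₀ _ (hq1 z)]
      · intro w _ hw
        rw [map_mul, hq0 w z (Ne.symm hw), mul_zero]
      · simp
    rw [this]
    exact hmem _ _ le_rfl
  have h1 : Module.finrank ℝ (Z → ℝ) ≤ Fintype.card (Fin n → Fin m) := by
    rw [← finrank_top ℝ (Z → ℝ), ← htop]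
    exact finrank_range_le_card b
  simpa using h1

end MvPolynomial

/-! ### Grid cells and isolated sublevel components. -/

/-- The closed unit cell with lower corner `c` of the grid on `[0, q]ⁿ`. -/
def gridCell {n q : ℕ} (c : Fin n → Fin q) : Set (Fin n → ℝ) :=
  Set.Icc (fun i => ((c i : ℕ) : ℝ)) (fun i => ((c i : ℕ) : ℝ) + 1)

/-- The boundary of a grid cell. -/
def gridCellBoundary {n q : ℕ} (c : Fin n → Fin q) : Set (Fin n → ℝ) :=
  {z ∈ gridCell c | ∃ i, z i = (c i : ℕ) ∨ z i = ((c i : ℕ) : ℝ) + 1}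

theorem isCompact_gridCellBoundary {n q : ℕ} (c : Fin n → Fin q) :
    IsCompact (gridCellBoundary c) := by
  have : gridCellBoundary c = gridCell c ∩
      ⋃ i, ({z | z i = (c i : ℕ)} ∪ {z | z i = ((c i : ℕ) : ℝ) + 1}) := by
    ext z; simp [gridCellBoundary]
  rw [this]
  refine isCompact_Icc.inter_right (isClosed_iUnion_of_finite fun i => ?_)
  exact (isClosed_eq (continuous_apply i) continuous_const).union
    (isClosed_eq (continuous_apply i) continuous_const)

theorem gridCell_bounds {n q : ℕ} {c : Fin n → Fin q} {z : Fin n → ℝ} (hz : z ∈ gridCell c)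
    (i : Fin n) : z i ∈ Set.Icc (0 : ℝ) q := by
  have h1 := hz.1 i
  have h2 := hz.2 i
  have h3 : (((c i : ℕ) : ℝ)) + 1 ≤ q := by exact_mod_cast (c i).2
  exact ⟨(Nat.cast_nonneg _).trans h1, h2.trans h3⟩

/-- The number of grid cells in whose interior a polynomial of degree `≤ m` drops below a level
that it exceeds on the boundary of the cell is at most `m ^ n`. -/
theorem card_isolated_cells_le {n q m : ℕ} (hm : 0 < m) {P : MvPolynomial (Fin n) ℝ}
    (hP : P.totalDegree ≤ m) (a : ℝ) (S : Finset (Fin n → Fin q))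
    (hS : ∀ c ∈ S, (∃ z ∈ gridCell c, MvPolynomial.eval z P ≤ a) ∧
      ∀ z ∈ gridCellBoundary c, a < MvPolynomial.eval z P) : S.card ≤ m ^ n := by
  classical
  have hcont : ∀ p : MvPolynomial (Fin n) ℝ, Continuous fun z => MvPolynomial.eval z p :=
    fun p => MvPolynomial.continuous_eval p
  have hη : ∃ η > 0, ∀ c ∈ S, ∀ z ∈ gridCellBoundary c, a + η ≤ MvPolynomial.eval z P := by
    have hK : IsCompact (⋃ c ∈ S, gridCellBoundary c) :=
      S.isCompact_biUnion fun c _ => isCompact_gridCellBoundary c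
    rcases (⋃ c ∈ S, gridCellBoundary c).eq_empty_or_nonempty with h | h
    · refine ⟨1, one_pos, fun c hc z hz => ?_⟩
      have : z ∈ (⋃ c ∈ S, gridCellBoundary c) := Set.mem_biUnion hc hz
      rw [h] at this
      exact this.elim
    · obtain ⟨w, hw, hmin⟩ := hK.exists_isMinOn h (hcont P).continuousOn
      obtain ⟨c₀, hc₀, hw₀⟩ := Set.mem_iUnion₂.1 hw
      refine ⟨MvPolynomial.eval w P - a, sub_pos.2 ((hS c₀ hc₀).2 w hw₀), fun c hc z hz => ?_⟩
      have := hmin (Set.mem_biUnion hc hz)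
      simp only [Set.mem_ofPred_eq] at this
      linarith
  obtain ⟨η, hη0, hη⟩ := hη
  -- Small enough that the perturbation below stays under the gap `η` on all of `[0, q]ⁿ`.
  set ε : ℝ := η / (n * (q : ℝ) ^ (m + 1) + 1) with hε
  have hden : (0 : ℝ) < n * (q : ℝ) ^ (m + 1) + 1 := by positivity
  have hε0 : 0 < ε := div_pos hη0 hden
  -- The perturbation gives each partial derivative the leading term `ε (m + 1) z i ^ m`, so the
  -- zero count applies even when the critical points of `P` are not isolated.
  set P' : MvPolynomial (Fin n) ℝ :=
    P + MvPolynomial.C ε * ∑ i, MvPolynomial.X i ^ (m + 1) with hP'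
  have hev : ∀ z, MvPolynomial.eval z P'
      = MvPolynomial.eval z P + ε * ∑ i, z i ^ (m + 1) := by
    intro z; simp [hP']
  have hder : ∀ z i, MvPolynomial.eval z (MvPolynomial.pderiv i P')
      = ε * (m + 1) * z i ^ m + MvPolynomial.eval z (MvPolynomial.pderiv i P) := by
    intro z i
    rw [hP', map_add, MvPolynomial.pderiv_C_mul, map_sum, Finset.sum_eq_single i]
    · simp; ring
    · intro j _ hj
      rw [MvPolynomial.pderiv_pow, MvPolynomial.pderiv_X_of_ne hj, mul_zero]
    · simp
  have hcrit : ∀ c ∈ S, ∃ z : Fin n → ℝ, (∀ i, ((c i : ℕ) : ℝ) < z i ∧ z i < (c i : ℕ) + 1) ∧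
      ∀ i, ε * (m + 1) * z i ^ m + MvPolynomial.eval z (MvPolynomial.pderiv i P) = 0 := by
    intro c hc
    obtain ⟨⟨y, hy, hya⟩, -⟩ := hS c hc
    obtain ⟨z, hz, hmin⟩ := (isCompact_Icc : IsCompact (gridCell c)).exists_isMinOn ⟨y, hy⟩
      (hcont P').continuousOn
    -- A boundary minimum would exceed `a + η`, since the perturbation is nonnegative, while the
    -- value at `y` is below `a + η`.
    have hnb : z ∉ gridCellBoundary c := by
      intro hzb
      have h1 : MvPolynomial.eval z P' ≤ MvPolynomial.eval y P' := hmin hy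
      have h2 := hη c hc z hzb
      have h3 : 0 ≤ ∑ i, z i ^ (m + 1) :=
        Finset.sum_nonneg fun i _ => pow_nonneg (gridCell_bounds hz i).1 _
      have h4 : ∑ i, y i ^ (m + 1) ≤ n * (q : ℝ) ^ (m + 1) := by
        refine (Finset.sum_le_card_nsmul _ _ ((q : ℝ) ^ (m + 1)) fun i _ => ?_).trans_eq (by simp)
        exact pow_le_pow_left₀ (gridCell_bounds hy i).1 (gridCell_bounds hy i).2 _
      have h5 : ε * ∑ i, y i ^ (m + 1) < η := by
        rw [hε, div_mul_eq_mul_div, div_lt_iff₀ hden]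
        nlinarith
      rw [hev, hev] at h1
      have := mul_nonneg hε0.le h3
      linarith
    have hint : ∀ i, ((c i : ℕ) : ℝ) < z i ∧ z i < (c i : ℕ) + 1 := by
      intro i
      refine ⟨lt_of_le_of_ne (hz.1 i) fun h => hnb ⟨hz, i, Or.inl h.symm⟩,
        lt_of_le_of_ne (hz.2 i) fun h => hnb ⟨hz, i, Or.inr h⟩⟩
    refine ⟨z, hint, fun i => ?_⟩
    rw [← hder]
    have hd := MvPolynomial.hasDerivAt_eval_update P' i z (z i)
    rw [Function.update_eq_self] at hd
    refine IsLocalMin.hasDerivAt_eq_zero ?_ hd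
    filter_upwards [Ioo_mem_nhds (hint i).1 (hint i).2] with t ht
    rw [Function.update_eq_self]
    refine hmin ⟨fun j => ?_, fun j => ?_⟩
    · by_cases h : j = i
      · subst h; simpa using ht.1.le
      · simpa [h] using hz.1 j
    · by_cases h : j = i
      · subst h; simpa using ht.2.le
      · simpa [h] using hz.2 j
  choose! z hz1 hz2 using hcrit
  -- The critical points are interior to their cells, and distinct cells have disjoint interiors.
  have hinj : Set.InjOn z S := by
    intro c hc c' hc' h
    funext i
    have h1 := hz1 c hc i
    have h2 := hz1 c' hc' i
    rw [h] at h1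
    have h3 : ((c i : ℕ) : ℝ) < ((c' i : ℕ) : ℝ) + 1 := h1.1.trans h2.2
    have h4 : ((c' i : ℕ) : ℝ) < ((c i : ℕ) : ℝ) + 1 := h2.1.trans h1.2
    have h3' : (c i : ℕ) < c' i + 1 := by exact_mod_cast h3
    have h4' : (c' i : ℕ) < c i + 1 := by exact_mod_cast h4
    exact Fin.ext (by omega)
  rw [← Finset.card_image_of_injOn hinj]
  refine MvPolynomial.card_zeros_le_pow (e := ε * (m + 1)) (by positivity)
    (fun i => MvPolynomial.pderiv i P)
    (fun i => MvPolynomial.totalDegree_pderiv_lt P i hP hm) _ ?_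
  intro w hw i
  obtain ⟨c, hc, rfl⟩ := Finset.mem_image.1 hw
  exact hz2 c hc i

/-! ### Restriction to hyperplanes and lines; the norming inequality. -/

namespace MvPolynomial

theorem eval_aeval_eq {σ τ R : Type*} [CommSemiring R] (p : MvPolynomial σ R)
    (f : σ → MvPolynomial τ R) (z : τ → R) :
    eval z (aeval f p) = eval (fun i => eval z (f i)) p := by
  induction p using MvPolynomial.induction_on with
  | C a => simp
  | add p q hp hq => simp only [map_add, hp, hq]
  | mul_X p i hp => simp only [map_mul, hp, aeval_X, eval_X]

theorem eval_aeval_polynomial_eq {σ R : Type*} [CommSemiring R] (p : MvPolynomial σ R)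
    (f : σ → Polynomial R) (t : R) :
    (aeval f p).eval t = eval (fun i => (f i).eval t) p := by
  induction p using MvPolynomial.induction_on with
  | C a => simp
  | add p q hp hq => simp [hp, hq]
  | mul_X p i hp => simp [hp]

/-- The restriction of a polynomial to the hyperplane `x i = h`. -/
noncomputable def slice {n : ℕ} (p : MvPolynomial (Fin (n + 1)) ℝ) (i : Fin (n + 1)) (h : ℝ) :
    MvPolynomial (Fin n) ℝ :=
  aeval (i.insertNth (α := fun _ => MvPolynomial (Fin n) ℝ) (C h) X) p

theorem eval_slice {n : ℕ} (p : MvPolynomial (Fin (n + 1)) ℝ) (i : Fin (n + 1)) (h : ℝ)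
    (z : Fin n → ℝ) : eval z (p.slice i h) = eval (i.insertNth (α := fun _ => ℝ) h z) p := by
  rw [slice, eval_aeval_eq]
  congr 2
  funext j
  rcases Fin.eq_self_or_eq_succAbove i j with rfl | ⟨j, rfl⟩ <;> simp

theorem totalDegree_slice_le {n : ℕ} (p : MvPolynomial (Fin (n + 1)) ℝ) (i : Fin (n + 1))
    (h : ℝ) : (p.slice i h).totalDegree ≤ p.totalDegree := by
  refine totalDegree_aeval_le_of_totalDegree_le_one _ _ fun j => ?_
  rcases Fin.eq_self_or_eq_succAbove i j with rfl | ⟨j, rfl⟩ <;> simp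

/-- The restriction of a polynomial to the line through `x` in direction `i`. -/
noncomputable def line {n : ℕ} (p : MvPolynomial (Fin n) ℝ) (i : Fin n) (x : Fin n → ℝ) :
    Polynomial ℝ :=
  aeval (Function.update (fun j => Polynomial.C (x j)) i Polynomial.X) p

theorem eval_line {n : ℕ} (p : MvPolynomial (Fin n) ℝ) (i : Fin n) (x : Fin n → ℝ) (t : ℝ) :
    (p.line i x).eval t = eval (Function.update x i t) p := by
  rw [line, eval_aeval_polynomial_eq]
  congr 2
  funext j
  by_cases h : j = i
  · subst h; simp
  · simp [h]

theorem natDegree_line_le {n : ℕ} (p : MvPolynomial (Fin n) ℝ) (i : Fin n) (x : Fin n → ℝ) :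
    (p.line i x).natDegree ≤ p.totalDegree := by
  refine (aeval_natDegree_le (n := 1) p le_rfl _ fun j => ?_).trans_eq (mul_one _)
  by_cases h : j = i
  · subst h; simp
  · simp [h]

end MvPolynomial

theorem Finset.exists_separated_seq (T : Finset ℕ) {m : ℕ} (hm : m ≤ T.card) :
    ∃ e : ℕ → ℕ, (∀ i < m, e i ∈ T) ∧ ∀ i j, i ≤ j → j < m → e i + (j - i) ≤ e j := by
  have hfin : (Set.ofPred (· ∈ T)).Finite := T.finite_toSet
  have hcard : hfin.toFinset.card = T.card := by
    congr 1; ext; rw [Set.Finite.mem_toFinset]; rfl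
  refine ⟨Nat.nth (· ∈ T), fun i hi => Nat.nth_mem_of_lt_card hfin (by omega), ?_⟩
  intro i j hij
  induction j, hij using Nat.le_induction with
  | base => intro _; simp
  | succ j hij ih =>
    intro hj
    have h1 := ih (by omega)
    have h2 : Nat.nth (· ∈ T) j < Nat.nth (· ∈ T) (j + 1) :=
      Nat.nth_lt_nth_of_lt_card hfin (Nat.lt_succ_self j) (by omega)
    omega

theorem two_le_gammaSeq (n : ℕ) : 2 ≤ gammaSeq (n + 1) := by
  cases n with
  | zero => simp [gammaSeq]
  | succ n => simp only [gammaSeq]; nlinarith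

/-- The slice count that makes the induction on the dimension work. -/
theorem hits_count_lt {n d q g : ℕ} (hg : 2 ≤ g) (hq : 2 * (n + 2) * (1 + g) * (d + 1) ≤ q) :
    ((2 * (d + 1)) ^ (n + 2) : ℝ) + 2 * (n + 2) * ((q + 1) * (g * (d + 1) * q ^ n - 1)
      + d * (q ^ (n + 1) - (g * (d + 1) * q ^ n - 1)))
      < 2 * (n + 2) * (1 + g) * (d + 1) * q ^ (n + 1) := by
  have hq' : 2 * ((n : ℝ) + 2) * (1 + g) * (d + 1) ≤ q := by exact_mod_cast hq
  have hg' : (2 : ℝ) ≤ g := by exact_mod_cast hg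
  have hn : (0 : ℝ) ≤ n := n.cast_nonneg
  have hd : (0 : ℝ) ≤ d := d.cast_nonneg
  set k : ℝ := (d : ℝ) + 1 with hk
  have hk1 : 1 ≤ k := by linarith
  have hd' : (d : ℝ) = k - 1 := by linarith
  have hqk : 4 * (1 + (g : ℝ)) * k ≤ q := by
    refine le_trans ?_ hq'
    have : 0 ≤ (n : ℝ) * ((1 + g) * k) := by positivity
    nlinarith
  have hs : (2 * k) ^ n ≤ (q : ℝ) ^ n := by
    refine pow_le_pow_left₀ (by positivity) ?_ n
    nlinarith
  set s : ℝ := (q : ℝ) ^ n with hsdef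
  have hs0 : 0 < s := lt_of_lt_of_le (by positivity) hs
  have h1 : 2 * k ^ 2 ≤ q + (k - 2) * g * k := by
    nlinarith [mul_nonneg (sub_nonneg.2 hg') (sq_nonneg k), mul_pos (by linarith : (0 : ℝ) < g)
      (by linarith : 0 < k)]
  have h2 : 0 ≤ (q : ℝ) + 2 - k := by nlinarith
  have h3 : (2 * k) ^ (n + 2) ≤ 4 * k ^ 2 * s := by
    rw [pow_add]; nlinarith [sq_nonneg k]
  have h4 : 2 * k ^ 2 * s ≤ (q + (k - 2) * g * k) * s := mul_le_mul_of_nonneg_right h1 hs0.le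
  have h5 : 0 < 2 * k ^ 2 * s := by positivity
  rw [pow_succ (q : ℝ) n, ← hsdef, hd']
  -- Each of the `2(n+2)` kinds of face accounts for about `g k q^(n+1)` hits from poor hyperplanes
  -- and `(k-1) q^(n+1)` from rich ones. This explains the recursion for `γ`. The slack left over,
  -- because only `k - 1` hyperplanes can be rich, pays for the isolated cells.
  have key : 2 * ((n : ℝ) + 2) * (1 + g) * k * (s * q)
      - 2 * (n + 2) * ((q + 1) * (g * k * s - 1) + (k - 1) * (s * q - (g * k * s - 1)))
      = 2 * (n + 2) * ((q + (k - 2) * g * k) * s + (q + 2 - k)) := by ring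
  have h6 : 2 * k ^ 2 * s ≤ (q + (k - 2) * g * k) * s + (q + 2 - k) := by linarith
  have h7 := mul_le_mul_of_nonneg_left h6 (by positivity : (0 : ℝ) ≤ 2 * (n + 2))
  nlinarith

/-- The cells of the grid on the hyperplane `x i = h` on which `|p| ≤ M` somewhere. -/
noncomputable def hitCells {n : ℕ} (q : ℕ) (p : MvPolynomial (Fin (n + 1)) ℝ) (M : ℝ)
    (i : Fin (n + 1)) (h : ℕ) : Finset (Fin n → Fin q) :=
  open Classical in
  {c | ∃ z ∈ gridCell c, |MvPolynomial.eval (i.insertNth (α := fun _ => ℝ) h z) p| ≤ M}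

/-- Cells whose face in direction `i` is hit are counted by the slices orthogonal to `i`. -/
theorem card_face_hits_le {n q : ℕ} (p : MvPolynomial (Fin (n + 1)) ℝ) (M : ℝ) (i : Fin (n + 1))
    (b : Fin 2) (A : Finset (Fin (n + 1) → Fin q))
    (hA : ∀ c ∈ A, ∃ z ∈ gridCell c, |MvPolynomial.eval z p| ≤ M ∧ z i = (c i : ℕ) + (b : ℕ)) :
    A.card ≤ ∑ h ∈ Finset.range (q + 1), (hitCells q p M i h).card := by
  classical
  rw [Finset.card_eq_sum_card_fiberwise (f := fun c => (c i : ℕ) + (b : ℕ))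
    (t := Finset.range (q + 1))]
  · refine Finset.sum_le_sum fun h _ => ?_
    refine Finset.card_le_card_of_injOn (fun c => i.removeNth c) ?_ ?_
    · intro c hc
      obtain ⟨hcA, hch⟩ := Finset.mem_filter.1 hc
      obtain ⟨z, hz, hzM, hzi⟩ := hA c hcA
      simp only [hitCells, Finset.coe_filter, Finset.mem_univ, true_and, Set.mem_ofPred_eq]
      refine ⟨i.removeNth z, ⟨fun j => hz.1 _, fun j => hz.2 _⟩, ?_⟩
      have : (h : ℝ) = z i := by rw [hzi, ← hch]; push_cast; rfl
      rw [this, Fin.insertNth_self_removeNth]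
      exact hzM
    · intro c hc c' hc' hcc
      have h1 := (Finset.mem_filter.1 hc).2
      have h2 := (Finset.mem_filter.1 hc').2
      have h3 : c i = c' i := Fin.ext (by omega)
      rw [← Fin.insertNth_self_removeNth i c, ← Fin.insertNth_self_removeNth i c', h3]
      simp only at hcc
      rw [hcc]
  · intro c _
    have h1 := (c i).2
    have h2 := b.2
    simp only [Finset.coe_range, Set.mem_Iio]
    omega

/-- Charge `G - 1` to every index and the excess over it to the at most `d` large ones. Here the
indices will be parallel hyperplanes and `a` their numbers of hit cells. -/
theorem Finset.sum_le_of_few_large {ι : Type*} (s : Finset ι) (a : ι → ℕ) {d N G : ℕ}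
    (hGN : G ≤ N) (ha : ∀ i ∈ s, a i ≤ N) (hd : (s.filter fun i => G ≤ a i).card ≤ d) :
    ((∑ i ∈ s, a i : ℕ) : ℝ) ≤ s.card * ((G : ℝ) - 1) + d * (N - (G - 1)) := by
  have h1 : ∀ i ∈ s, (a i : ℝ) ≤ ((G : ℝ) - 1) + if G ≤ a i then ((N : ℝ) - (G - 1)) else 0 := by
    intro i hi
    split_ifs with h
    · have : (a i : ℝ) ≤ N := by exact_mod_cast ha i hi
      linarith
    · have : (a i : ℝ) + 1 ≤ G := by exact_mod_cast (not_le.1 h)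
      linarith
  push_cast
  refine (Finset.sum_le_sum h1).trans ?_
  rw [Finset.sum_add_distrib, Finset.sum_const, nsmul_eq_mul, ← Finset.sum_filter,
    Finset.sum_const, nsmul_eq_mul]
  have h2 : ((s.filter fun i => G ≤ a i).card : ℝ) ≤ d := by exact_mod_cast hd
  have h3 : (G : ℝ) ≤ N := by exact_mod_cast hGN
  gcongr
  linarith

/-- A polynomial of degree `≤ d` that is at most `M` somewhere in each of sufficiently many grid
cells is bounded on the whole cube. -/
theorem abs_eval_le_of_many_hits (n d q : ℕ) (hq : 0 < q) (M : ℝ)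
    (p : MvPolynomial (Fin (n + 1)) ℝ) (hp : p.totalDegree ≤ d)
    (A : Finset (Fin (n + 1) → Fin q)) (hcard : gammaSeq (n + 1) * (d + 1) * q ^ n ≤ A.card)
    (hA : ∀ c ∈ A, ∃ z ∈ gridCell c, |MvPolynomial.eval z p| ≤ M)
    (x : Fin (n + 1) → ℝ) (hx : ∀ i, x i ∈ Set.Icc (0 : ℝ) q) :
    |MvPolynomial.eval x p| ≤ ((2 * (q : ℝ)) ^ d / d.factorial) ^ (n + 1) * M := by
  classical
  induction n with
  | zero =>
    have hcardT : (A.image fun c => (c 0 : ℕ)).card = A.card := by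
      refine Finset.card_image_of_injective _ fun c c' h => ?_
      funext i
      obtain rfl : i = 0 := Subsingleton.elim (α := Fin 1) i 0
      exact Fin.ext h
    -- Since `γ₁ = 2`, there are `2(d+1)` hit intervals; points in every second one are separated
    -- like integers.
    obtain ⟨e, he, hsep⟩ := Finset.exists_separated_seq (A.image fun c => (c 0 : ℕ))
      (m := 2 * (d + 1)) (by rw [hcardT]; simpa [gammaSeq] using hcard)
    have hz : ∀ i ≤ d, ∃ z : Fin 1 → ℝ, |MvPolynomial.eval z p| ≤ M ∧
        z 0 ∈ Set.Icc (0 : ℝ) q ∧ (e (2 * i) : ℝ) ≤ z 0 ∧ z 0 ≤ (e (2 * i) : ℝ) + 1 := by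
      intro i hi
      obtain ⟨c, hc, hce⟩ := Finset.mem_image.1 (he (2 * i) (by omega))
      obtain ⟨z, hzc, hzM⟩ := hA c hc
      refine ⟨z, hzM, gridCell_bounds hzc 0, ?_, ?_⟩
      · rw [← hce]; exact hzc.1 0
      · rw [← hce]; exact hzc.2 0
    choose! z hzM hzI hz1 hz2 using hz
    have heval : ∀ w : Fin 1 → ℝ, (p.line 0 x).eval (w 0) = MvPolynomial.eval w p := by
      intro w
      rw [MvPolynomial.eval_line]
      congr 2
      funext i
      obtain rfl : i = 0 := Subsingleton.elim (α := Fin 1) i 0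
      simp
    have hpow : ((2 * (q : ℝ)) ^ d / d.factorial) ^ (0 + 1) = (2 * (q : ℝ)) ^ d / d.factorial :=
      pow_one _
    rw [← heval, hpow]
    refine Polynomial.abs_eval_le_of_separated ((p.natDegree_line_le 0 x).trans hp)
      (y := fun i => z i 0) hzI ?_ (fun i hi => by rw [heval]; exact hzM i hi) (hx 0)
    intro i j hij hj
    have h1 := hsep (2 * i) (2 * j) (by omega) (by omega)
    have h2 : e (2 * i) + 1 + (j - i) ≤ e (2 * j) := by omega
    have h3 : (e (2 * i) : ℝ) + 1 + (j - i) ≤ e (2 * j) := by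
      rw [← Nat.cast_sub hij.le]; exact_mod_cast h2
    have := hz1 j hj
    have := hz2 i (hij.le.trans hj)
    linarith
  | succ n ih =>
    set g := gammaSeq (n + 1) with hgdef
    have hg2 : 2 ≤ g := two_le_gammaSeq n
    have hgs : gammaSeq (n + 2) = 2 * (n + 2) * (1 + g) := rfl
    set G := g * (d + 1) * q ^ n with hG
    -- The grid is automatically fine, since there are at most `q ^ (n + 2)` cells to be hit.
    have hqbig : 2 * (n + 2) * (1 + g) * (d + 1) ≤ q := by
      have h1 : A.card ≤ q ^ (n + 1) * q := by
        refine (Finset.card_le_univ A).trans_eq ?_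
        simp [pow_succ]
      rw [hgs] at hcard
      have h2 : q ^ (n + 1) * (2 * (n + 2) * (1 + g) * (d + 1)) ≤ q ^ (n + 1) * q := by
        rw [mul_comm]; exact hcard.trans h1
      exact Nat.le_of_mul_le_mul_left h2 (by positivity)
    by_cases hgood : ∃ i : Fin (n + 2),
        d + 1 ≤ ((Finset.range (q + 1)).filter fun h => G ≤ (hitCells q p M i h).card).card
    · obtain ⟨i, hi⟩ := hgood
      obtain ⟨e, he, hsep⟩ := Finset.exists_separated_seq _ hi
      have hslice : ∀ j ≤ d, |(p.line i x).eval (e j : ℝ)|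
          ≤ ((2 * (q : ℝ)) ^ d / d.factorial) ^ (n + 1) * M := by
        intro j hj
        have hej := (Finset.mem_filter.1 (he j (by omega))).2
        rw [MvPolynomial.eval_line, ← Fin.insertNth_self_removeNth i (Function.update x i _),
          Function.update_self, ← MvPolynomial.eval_slice]
        refine ih _ ((p.totalDegree_slice_le i _).trans hp) _ hej (fun c hc => ?_) _ (fun l => ?_)
        · simp only [hitCells, Finset.mem_filter, Finset.mem_univ, true_and] at hc
          simpa only [MvPolynomial.eval_slice] using hc
        · simpa [Fin.removeNth] using hx (i.succAbove l)
      have h1 := Polynomial.abs_eval_le_of_separated ((p.natDegree_line_le i x).trans hp)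
        (y := fun j => (e j : ℝ)) (Q := q) (fun j hj => ?_) (fun j l hjl hl => ?_) hslice (hx i)
      · rw [MvPolynomial.eval_line, Function.update_eq_self] at h1
        rw [pow_succ' _ (n + 1), mul_assoc]
        exact h1
      · have := Finset.mem_range.1 (Finset.mem_filter.1 (he j (by omega))).1
        exact ⟨Nat.cast_nonneg _, by exact_mod_cast Nat.lt_succ_iff.1 this⟩
      · have h1 := hsep j l hjl.le (by omega)
        have h2 : (e j : ℝ) + (l - j) ≤ e l := by
          rw [← Nat.cast_sub hjl.le]; exact_mod_cast h1
        linarith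
    · push Not at hgood
      exfalso
      have hM0 : 0 ≤ M := by
        have : A.Nonempty := by
          rw [← Finset.card_pos]
          refine lt_of_lt_of_le ?_ hcard
          rw [hgs]; positivity
        obtain ⟨c, hc⟩ := this
        obtain ⟨z, -, hz⟩ := hA c hc
        exact (abs_nonneg _).trans hz
      -- The cells with a hit on the lower or upper face in a given direction; the remaining cells
      -- `I` are isolated.
      let F : Fin (n + 2) × Fin 2 → Finset (Fin (n + 2) → Fin q) := fun r => A.filter fun c =>
        ∃ z ∈ gridCell c, |MvPolynomial.eval z p| ≤ M ∧ z r.1 = (c r.1 : ℕ) + ((r.2 : ℕ) : ℝ)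
      let I := A.filter fun c => ∀ z ∈ gridCellBoundary c, M < |MvPolynomial.eval z p|
      have hcover : A ⊆ I ∪ Finset.univ.biUnion F := by
        intro c hc
        by_cases h : ∀ z ∈ gridCellBoundary c, M < |MvPolynomial.eval z p|
        · exact Finset.mem_union_left _ (Finset.mem_filter.2 ⟨hc, h⟩)
        · push Not at h
          obtain ⟨z, ⟨hz, i, hzi⟩, hzM⟩ := h
          refine Finset.mem_union_right _ (Finset.mem_biUnion.2 ?_)
          rcases hzi with hzi | hzi
          · exact ⟨(i, 0), Finset.mem_univ _, Finset.mem_filter.2 ⟨hc, z, hz, hzM, by simp [hzi]⟩⟩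
          · exact ⟨(i, 1), Finset.mem_univ _, Finset.mem_filter.2 ⟨hc, z, hz, hzM, by simp [hzi]⟩⟩
      -- Squaring makes `|p| ≤ M` a polynomial sublevel condition. The bound `2(d+1)` for the
      -- degree, instead of `2d`, stays positive at `d = 0`.
      have hI : I.card ≤ (2 * (d + 1)) ^ (n + 2) := by
        refine card_isolated_cells_le (P := p ^ 2) (by omega)
          ((MvPolynomial.totalDegree_pow _ _).trans (by omega)) (M ^ 2) I fun c hc => ?_
        obtain ⟨hcA, hcb⟩ := Finset.mem_filter.1 hc
        obtain ⟨z, hz, hzM⟩ := hA c hcA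
        refine ⟨⟨z, hz, ?_⟩, fun w hw => ?_⟩
        · rw [map_pow]; exact sq_le_sq' (by linarith [(abs_le.1 hzM).1]) (abs_le.1 hzM).2
        · rw [map_pow, ← sq_abs (MvPolynomial.eval w p)]
          exact pow_lt_pow_left₀ (hcb w hw) hM0 two_ne_zero
      have hGN : G ≤ q ^ (n + 1) := by
        rw [hG, pow_succ, mul_comm (q ^ n)]
        refine Nat.mul_le_mul_right _ (le_trans ?_ hqbig)
        exact Nat.mul_le_mul_right _ (by nlinarith)
      have hF : ∀ r, ((F r).card : ℝ)
          ≤ (q + 1) * ((G : ℝ) - 1) + d * ((q : ℝ) ^ (n + 1) - (G - 1)) := by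
        intro r
        have h1 := card_face_hits_le p M r.1 r.2 (F r) fun c hc => (Finset.mem_filter.1 hc).2
        have h2 := Finset.sum_le_of_few_large (Finset.range (q + 1))
          (fun h => (hitCells q p M r.1 h).card) (d := d) (N := q ^ (n + 1)) (G := G)
          hGN
          (fun h _ => (Finset.card_le_univ _).trans_eq (by simp))
          (Nat.lt_succ_iff.1 (hgood r.1))
        have h3 : ((F r).card : ℝ)
            ≤ ((∑ h ∈ Finset.range (q + 1), (hitCells q p M r.1 h).card : ℕ) : ℝ) := by
          exact_mod_cast h1
        refine h3.trans (h2.trans_eq ?_)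
        simp
      have hAcard : (A.card : ℝ) ≤ (2 * (d + 1)) ^ (n + 2)
          + 2 * (n + 2) * ((q + 1) * ((G : ℝ) - 1) + d * ((q : ℝ) ^ (n + 1) - (G - 1))) := by
        have h1 : A.card ≤ I.card + ∑ r, (F r).card :=
          (Finset.card_le_card hcover).trans ((Finset.card_union_le _ _).trans
            (Nat.add_le_add_left Finset.card_biUnion_le _))
        have h2 : (A.card : ℝ) ≤ I.card + ∑ r, ((F r).card : ℝ) := by exact_mod_cast h1
        have h3 : (I.card : ℝ) ≤ (2 * (d + 1)) ^ (n + 2) := by exact_mod_cast hI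
        refine h2.trans (add_le_add h3 ((Finset.sum_le_sum fun r _ => hF r).trans_eq ?_))
        simp
        ring
      have h1 := hits_count_lt hg2 hqbig
      have h2 : (2 * (n + 2) * (1 + g) * (d + 1) * q ^ (n + 1) : ℝ) ≤ A.card := by
        rw [hgs] at hcard; exact_mod_cast hcard
      have h3 : (G : ℝ) = g * (d + 1) * q ^ n := by rw [hG]; push_cast; ring
      rw [h3] at hAcard
      linarith

/-- A polynomial of degree `< k` on a cube that is cut into `(γₙ k)ⁿ` cells is controlled by its
values at one point of each cell. -/
theorem abs_eval_le_exp_mul_of_cells {n k : ℕ} (hn : 1 ≤ n) (hk : 1 ≤ k) {M : ℝ}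
    {p : MvPolynomial (Fin n) ℝ} (hp : p.totalDegree < k)
    {y : (Fin n → Fin (gammaSeq n * k)) → Fin n → ℝ} (hy : ∀ c, y c ∈ gridCell c)
    (hM : ∀ c, |MvPolynomial.eval (y c) p| ≤ M)
    {x : Fin n → ℝ} (hx : ∀ i, x i ∈ Set.Icc (0 : ℝ) ((gammaSeq n * k : ℕ) : ℝ)) :
    |MvPolynomial.eval x p| ≤ Real.exp (2 * n * gammaSeq n * k) * M := by
  obtain ⟨n, rfl⟩ := Nat.exists_eq_add_of_le' hn
  obtain ⟨d, rfl⟩ := Nat.exists_eq_add_of_le' hk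
  have hq0 : 0 < gammaSeq (n + 1) * (d + 1) := Nat.mul_pos (by linarith [two_le_gammaSeq n]) (Nat.succ_pos _)
  have h := abs_eval_le_of_many_hits n d _ hq0 M p (Nat.lt_succ_iff.1 hp) Finset.univ
    (by simp [pow_succ, mul_comm]) (fun c _ => ⟨y c, hy c, hM c⟩) x hx
  have hM0 : 0 ≤ M := (abs_nonneg _).trans (hM fun _ => ⟨0, hq0⟩)
  refine h.trans (mul_le_mul_of_nonneg_right ?_ hM0)
  have h1 : (2 * ((gammaSeq (n + 1) * (d + 1) : ℕ) : ℝ)) ^ d / d.factorial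
      ≤ Real.exp (2 * ((gammaSeq (n + 1) * (d + 1) : ℕ) : ℝ)) :=
    Real.pow_div_factorial_le_exp _ (by positivity) d
  refine (pow_le_pow_left₀ (by positivity) h1 _).trans_eq ?_
  rw [← Real.exp_nat_mul]
  push_cast
  ring_nf

/-! ### Duality and weights of small Gaussian energy. -/

/-- A functional that is controlled by the values of finitely many functionals is a combination
of them with small coefficients. -/
theorem exists_weights_of_abs_le {V ι : Type*} [AddCommGroup V] [Module ℝ V] [Fintype ι]
    (T : V →ₗ[ℝ] (ι → ℝ)) (φ : V →ₗ[ℝ] ℝ) (L : ℝ)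
    (hL : ∀ v M, (∀ i, |T v i| ≤ M) → 0 ≤ M → |φ v| ≤ L * M) :
    ∃ σ : ι → ℝ, (∀ v, φ v = ∑ i, σ i * T v i) ∧ ∑ i, |σ i| ≤ L := by
  classical
  have hL0 : 0 ≤ L := by
    have := hL 0 1 (by simp) zero_le_one
    simpa using this
  obtain ⟨r, hr⟩ := T.rangeRestrict.exists_rightInverse_of_surjective T.range_rangeRestrict
  have hTr : ∀ w : LinearMap.range T, T (r w) = w := fun w => by
    have := congrArg (fun f => ((f w : LinearMap.range T) : ι → ℝ)) hr
    simpa using this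
  -- The hypothesis with `M = 0` makes `φ` vanish on the kernel of `T`, so `φ` factors through the
  -- range.
  have hker : ∀ v, φ (r (T.rangeRestrict v)) = φ v := by
    intro v
    have h0 : T (r (T.rangeRestrict v) - v) = 0 := by
      rw [map_sub, hTr]; simp
    have := hL (r (T.rangeRestrict v) - v) 0 (by simp [h0]) le_rfl
    rw [mul_zero, map_sub] at this
    exact sub_eq_zero.1 (abs_nonpos_iff.1 this)
  obtain ⟨g, hg1, hg2⟩ := exists_extension_of_le_sublinear
    (⟨LinearMap.range T, φ ∘ₗ r⟩ : (ι → ℝ) →ₗ.[ℝ] ℝ) (fun w => L * ‖w‖)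
    (fun c hc w => by rw [norm_smul, Real.norm_of_nonneg hc.le]; ring)
    (fun v w => by rw [← mul_add]; exact mul_le_mul_of_nonneg_left (norm_add_le _ _) hL0)
    (fun w => by
      refine (le_abs_self _).trans (hL (r w) _ (fun i => ?_) (norm_nonneg _))
      rw [hTr]
      exact norm_le_pi_norm (w : ι → ℝ) i)
  have hgsum : ∀ w, g w = ∑ i, g (Pi.single i 1) * w i := by
    intro w
    rw [LinearMap.pi_apply_eq_sum_univ g w]
    refine Finset.sum_congr rfl fun i _ => ?_
    rw [smul_eq_mul, mul_comm]
    congr 2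
    funext j
    simp [Pi.single_apply, eq_comm]
  refine ⟨fun i => g (Pi.single i 1), fun v => ?_, ?_⟩
  · rw [← hgsum, ← hker]
    exact (hg1 (T.rangeRestrict v)).symm
  · have h1 := hg2 fun i => (SignType.sign (g (Pi.single i 1)) : ℝ)
    rw [hgsum] at h1
    simp only [self_mul_sign] at h1
    refine h1.trans ((mul_le_mul_of_nonneg_left ?_ hL0).trans_eq (mul_one L))
    refine (pi_norm_le_iff_of_nonneg zero_le_one).2 fun i => ?_
    rcases lt_trichotomy (g (Pi.single i 1)) 0 with h | h | h <;> simp [h]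

/-- From the `k`-th term on, the exponential series is dominated by a geometric series of ratio 1/2;
hence the factor 2. -/
theorem abs_exp_sub_sum_le {t : ℝ} {k : ℕ} (ht : |t| ≤ (k + 1) / 2) :
    |Real.exp t - ∑ m ∈ Finset.range k, t ^ m / m.factorial| ≤ |t| ^ k / k.factorial * 2 := by
  have h := Complex.exp_bound' (x := (t : ℂ)) (n := k) (by
    rw [Complex.norm_real, Real.norm_eq_abs, div_le_iff₀ (by positivity)]
    push_cast
    linarith)
  rw [Complex.norm_real, Real.norm_eq_abs] at h
  rw [← Real.norm_eq_abs, ← Complex.norm_real]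
  push_cast
  exact h

/-- A combination of point masses, one in each cell and a unit mass at `x`, with small
Gaussian energy. -/
theorem exists_gaussian_weights {n k : ℕ} (hn : 1 ≤ n) (hk : 1 ≤ k) {b : ℝ} (hb : 0 ≤ b)
    (hbk : 2 * b * (n * ((gammaSeq n * k : ℕ) : ℝ) ^ 2) ≤ (k + 1) / 2)
    {y : (Fin n → Fin (gammaSeq n * k)) → Fin n → ℝ} (hy : ∀ c, y c ∈ gridCell c)
    {x : Fin n → ℝ} (hx : ∀ i, x i ∈ Set.Icc (0 : ℝ) ((gammaSeq n * k : ℕ) : ℝ)) :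
    ∃ v : Option (Fin n → Fin (gammaSeq n * k)) → ℝ, v none = 1 ∧
      ∑ a, ∑ a', v a * v a' * Real.exp (-b * ∑ i, (a.elim x y i - a'.elim x y i) ^ 2)
        ≤ Real.exp (2 * n * gammaSeq n * k) ^ 2 *
          ((2 * b * (n * ((gammaSeq n * k : ℕ) : ℝ) ^ 2)) ^ k / k.factorial * 2) := by
  classical
  set q : ℝ := ((gammaSeq n * k : ℕ) : ℝ) with hq
  set L : ℝ := Real.exp (2 * n * gammaSeq n * k) with hL
  set t₀ : ℝ := 2 * b * (n * q ^ 2) with ht₀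
  set R : ℝ := t₀ ^ k / k.factorial * 2 with hR
  have ht₀0 : 0 ≤ t₀ := by positivity
  have hR0 : 0 ≤ R := by positivity
  let V := MvPolynomial.restrictTotalDegree (Fin n) ℝ (k - 1)
  have hV : ∀ p : MvPolynomial (Fin n) ℝ, p.totalDegree < k → p ∈ V := fun p hp => by
    rw [MvPolynomial.mem_restrictTotalDegree]; omega
  let ev : (Fin n → ℝ) → MvPolynomial (Fin n) ℝ →ₗ[ℝ] ℝ :=
    fun z => (MvPolynomial.aeval z).toLinearMap
  have hev : ∀ z p, ev z p = MvPolynomial.eval z p := fun z p => by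
    simp [ev]
  obtain ⟨σ, hσ1, hσ2⟩ := exists_weights_of_abs_le
    ((LinearMap.pi fun c => ev (y c)) ∘ₗ V.subtype) (ev x ∘ₗ V.subtype) L (by
      intro p M hM _
      simp only [LinearMap.coe_comp, Submodule.coe_subtype, Function.comp_apply,
        LinearMap.pi_apply, hev] at hM ⊢
      refine abs_eval_le_exp_mul_of_cells hn hk ?_ hy hM hx
      have := (MvPolynomial.mem_restrictTotalDegree _ _ _).1 p.2
      omega)
  have hσ : ∀ p : MvPolynomial (Fin n) ℝ, p.totalDegree < k →
      MvPolynomial.eval x p = ∑ c, σ c * MvPolynomial.eval (y c) p := by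
    intro p hp
    have := hσ1 ⟨p, hV p hp⟩
    simpa [hev] using this
  set P : Option (Fin n → Fin (gammaSeq n * k)) → Fin n → ℝ := fun a => a.elim x y with hP
  set u : Option (Fin n → Fin (gammaSeq n * k)) → Fin n → ℝ := fun a i => P a i - x i with hu
  -- Evaluation at `x` minus its representation by `σ`: this annihilates all polynomials of degree
  -- `< k`.
  set μ : Option (Fin n → Fin (gammaSeq n * k)) → ℝ := fun a => a.elim 1 fun c => -σ c with hμ
  have hPI : ∀ a i, P a i ∈ Set.Icc (0 : ℝ) q := by
    rintro (_ | c) i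
    · exact hx i
    · exact gridCell_bounds (hy c) i
  have hu0 : ∀ i, u none i = 0 := fun i => sub_self _
  have hmom : ∀ a, ∀ j < k, ∑ a', μ a' * (∑ i, u a i * u a' i) ^ j = 0 := by
    intro a j hj
    let p : MvPolynomial (Fin n) ℝ :=
      (∑ i, MvPolynomial.C (u a i) * (MvPolynomial.X i - MvPolynomial.C (x i))) ^ j
    have hpe : ∀ z, MvPolynomial.eval z p = (∑ i, u a i * (z i - x i)) ^ j := by
      intro z; simp [p]
    have hpd : p.totalDegree < k := by
      refine lt_of_le_of_lt ((MvPolynomial.totalDegree_pow _ _).trans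
        ((Nat.mul_le_mul_left j (?_ : _ ≤ 1)).trans_eq (mul_one j))) hj
      refine MvPolynomial.totalDegree_finsetSum_le fun i _ => ?_
      refine (MvPolynomial.totalDegree_mul _ _).trans ?_
      rw [MvPolynomial.totalDegree_C, zero_add]
      refine (MvPolynomial.totalDegree_sub _ _).trans ?_
      simp
    have := hσ p hpd
    rw [Fintype.sum_option]
    simp only [hpe] at this
    simp only [hμ, Option.elim_none, Option.elim_some, one_mul, hu, hP, neg_mul,
      Finset.sum_neg_distrib]
    simp only [hu, hP] at this
    linarith
  let S : ℝ → ℝ := fun t => ∑ m ∈ Finset.range k, t ^ m / m.factorial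
  let ip : Option (Fin n → Fin (gammaSeq n * k)) → Option (Fin n → Fin (gammaSeq n * k)) → ℝ :=
    fun a a' => 2 * b * ∑ i, u a i * u a' i
  have hS : ∀ a, ∑ a', μ a' * S (ip a a') = 0 := by
    intro a
    have : ∀ a', μ a' * S (ip a a') = ∑ m ∈ Finset.range k,
        (2 * b) ^ m / m.factorial * (μ a' * (∑ i, u a i * u a' i) ^ m) := by
      intro a'
      simp only [S, ip, Finset.mul_sum, mul_pow]
      exact Finset.sum_congr rfl fun m _ => by rw [← Finset.mul_sum]; ring
    simp only [this]
    rw [Finset.sum_comm]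
    refine Finset.sum_eq_zero fun m hm => ?_
    rw [← Finset.mul_sum, hmom a m (Finset.mem_range.1 hm), mul_zero]
  have hip : ∀ a a', |ip a a'| ≤ t₀ := by
    intro a a'
    rw [abs_mul, abs_of_nonneg (by positivity : 0 ≤ 2 * b), ht₀]
    refine mul_le_mul_of_nonneg_left ?_ (by positivity)
    refine (Finset.abs_sum_le_sum_abs _ _).trans
      ((Finset.sum_le_card_nsmul _ _ (q ^ 2) fun i _ => ?_).trans_eq (by simp))
    have hui : ∀ a, |u a i| ≤ q := fun a => by
      have h1 := hPI a i
      have h2 := hx i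
      rw [abs_le]
      constructor <;> simp only [hu] <;> linarith [h1.1, h1.2, h2.1, h2.2]
    rw [abs_mul, sq]
    exact mul_le_mul (hui a) (hui a') (abs_nonneg _) (by positivity)
  have hrem : ∀ a a', |Real.exp (ip a a') - S (ip a a')| ≤ R := by
    intro a a'
    refine (abs_exp_sub_sum_le ((hip a a').trans hbk)).trans ?_
    rw [hR]
    gcongr
    exact hip a a'
  -- The remainder thus vanishes at 0. As `u none = 0`, pairs involving `x` contribute nothing to
  -- the energy, and the bound is `L ^ 2` instead of `(1 + L) ^ 2`. This needs `1 ≤ k`.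
  have hS0 : S 0 = 1 := by
    obtain ⟨k, rfl⟩ := Nat.exists_eq_add_of_le' hk
    simp only [S]
    rw [Finset.sum_range_succ']
    simp
  have hnone1 : ∀ a, ip none a = 0 := fun a => by simp [ip, hu0]
  have hnone2 : ∀ a, ip a none = 0 := fun a => by simp [ip, hu0]
  -- The exponential factors cancel the diagonal part of the kernel and leave `exp (ip a a')`.
  refine ⟨fun a => μ a * Real.exp (b * ∑ i, u a i ^ 2), by simp [hμ, hu0], ?_⟩
  have hterm : ∀ a a', (μ a * Real.exp (b * ∑ i, u a i ^ 2))
      * (μ a' * Real.exp (b * ∑ i, u a' i ^ 2)) * Real.exp (-b * ∑ i, (P a i - P a' i) ^ 2)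
      = μ a * (μ a' * (Real.exp (ip a a') - S (ip a a'))) + μ a * (μ a' * S (ip a a')) := by
    intro a a'
    have : Real.exp (ip a a') = Real.exp (b * ∑ i, u a i ^ 2) * Real.exp (b * ∑ i, u a' i ^ 2)
        * Real.exp (-b * ∑ i, (P a i - P a' i) ^ 2) := by
      rw [← Real.exp_add, ← Real.exp_add]
      congr 1
      simp only [ip, Finset.mul_sum, ← Finset.sum_add_distrib, hu]
      exact Finset.sum_congr rfl fun i _ => by ring
    rw [this]; ring
  have hinner : ∀ a, ∑ a', (μ a * Real.exp (b * ∑ i, u a i ^ 2))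
      * (μ a' * Real.exp (b * ∑ i, u a' i ^ 2)) * Real.exp (-b * ∑ i, (P a i - P a' i) ^ 2)
      = μ a * ∑ a', μ a' * (Real.exp (ip a a') - S (ip a a')) := by
    intro a
    simp only [hterm, Finset.sum_add_distrib]
    rw [← Finset.mul_sum, ← Finset.mul_sum, hS, mul_zero, add_zero]
  have hsum : ∑ a, ∑ a', (μ a * Real.exp (b * ∑ i, u a i ^ 2))
      * (μ a' * Real.exp (b * ∑ i, u a' i ^ 2)) * Real.exp (-b * ∑ i, (P a i - P a' i) ^ 2)
      = ∑ c, μ (some c) * ∑ c', μ (some c') * (Real.exp (ip (some c) (some c'))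
          - S (ip (some c) (some c'))) := by
    simp only [hinner]
    rw [Fintype.sum_option]
    simp only [hnone1, Real.exp_zero, hS0, sub_self, mul_zero, Finset.sum_const_zero, zero_add]
    refine Finset.sum_congr rfl fun c _ => ?_
    rw [Fintype.sum_option, hnone2, Real.exp_zero, hS0, sub_self, mul_zero, zero_add]
  refine hsum.trans_le ?_
  calc ∑ c, μ (some c) * ∑ c', μ (some c') * (Real.exp (ip (some c) (some c'))
          - S (ip (some c) (some c')))
      ≤ ∑ c, |σ c| * ∑ c', |σ c'| * R := by
        refine Finset.sum_le_sum fun c _ => (le_abs_self _).trans ?_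
        rw [abs_mul]
        refine mul_le_mul (by simp [hμ]) ?_ (abs_nonneg _) (abs_nonneg _)
        refine (Finset.abs_sum_le_sum_abs _ _).trans (Finset.sum_le_sum fun c' _ => ?_)
        rw [abs_mul]
        exact mul_le_mul (by simp [hμ]) (hrem _ _) (abs_nonneg _) (abs_nonneg _)
    _ = (∑ c, |σ c|) ^ 2 * R := by
        rw [← Finset.sum_mul, ← Finset.sum_mul]; ring
    _ ≤ L ^ 2 * R := by
        gcongr

/-! ### From test functions to point masses. -/

/-- The value `∑ᵢ ∑ⱼ wᵢ conj wⱼ h(yᵢ - yⱼ)` of the energy of `h` at the measure `∑ᵢ wᵢ δ_{yᵢ}`. -/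
noncomputable def gramForm {n : ℕ} (h : RSpace n → ℂ) {ι : Type*} [Fintype ι] (y : ι → RSpace n)
    (w : ι → ℂ) : ℂ :=
  ∑ i, ∑ j, w i * conj (w j) * h (y i - y j)

/-- A smooth bump at `a` with support in the ball of radius `1 / (N + 1)`. -/
noncomputable def shrinkingBump {n : ℕ} (a : RSpace n) (N : ℕ) : ContDiffBump a where
  rIn := 1 / ((N : ℝ) + 2)
  rOut := 1 / ((N : ℝ) + 1)
  rIn_pos := by positivity
  rIn_lt_rOut := one_div_lt_one_div_of_lt (by positivity) (by linarith)

/-- The mollifier at `a`, as a complex-valued function. -/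
noncomputable def mollifier {n : ℕ} (a : RSpace n) (N : ℕ) (x : RSpace n) : ℂ :=
  (((shrinkingBump a N).normed volume x : ℝ) : ℂ)

section mollifier

variable {n : ℕ} (a : RSpace n) (N : ℕ)

theorem contDiff_mollifier : ContDiff ℝ ∞ (mollifier a N) :=
  Complex.ofRealCLM.contDiff.comp (shrinkingBump a N).contDiff_normed

theorem continuous_mollifier : Continuous (mollifier a N) :=
  (contDiff_mollifier a N).continuous

theorem hasCompactSupport_mollifier : HasCompactSupport (mollifier a N) :=
  (shrinkingBump a N).hasCompactSupport_normed.comp_left (g := fun t : ℝ => (t : ℂ)) rfl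

theorem integrable_mollifier_mul {g : RSpace n → ℂ} (hg : Continuous g) :
    Integrable fun x => mollifier a N x * g x :=
  ((continuous_mollifier a N).mul hg).integrable_of_hasCompactSupport
    (hasCompactSupport_mollifier a N).mul_right

theorem norm_integral_mollifier_mul_sub_le {g : RSpace n → ℂ} (hg : Continuous g) {v : ℂ} {ε : ℝ}
    (h : ∀ x ∈ Metric.ball a (1 / ((N : ℝ) + 1)), ‖g x - v‖ ≤ ε) :
    ‖(∫ x, mollifier a N x * g x) - v‖ ≤ ε := by
  set η := (shrinkingBump a N).normed volume with hη
  have hη0 : ∀ x, 0 ≤ η x := fun x => (shrinkingBump a N).nonneg_normed x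
  have hη1 : ∫ x, η x = 1 := (shrinkingBump a N).integral_normed
  have hηi : Integrable η := (shrinkingBump a N).integrable_normed
  have hm : ∀ x, mollifier a N x = (η x : ℂ) := fun x => rfl
  have h1 : (∫ x, mollifier a N x) = 1 := by
    simp only [hm, integral_complex_ofReal, hη1, Complex.ofReal_one]
  have h2 : (∫ x, mollifier a N x * g x) - v = ∫ x, mollifier a N x * (g x - v) := by
    simp only [mul_sub]
    rw [integral_sub (integrable_mollifier_mul a N hg)
      (integrable_mollifier_mul a N continuous_const), integral_mul_const, h1, one_mul]
  rw [h2]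
  refine (norm_integral_le_of_norm_le (g := fun x => η x * ε) (hηi.mul_const _)
    (Filter.Eventually.of_forall fun x => ?_)).trans_eq ?_
  · rw [norm_mul, hm, Complex.norm_real, Real.norm_of_nonneg (hη0 x)]
    by_cases hx : x ∈ Metric.ball a (1 / ((N : ℝ) + 1))
    · exact mul_le_mul_of_nonneg_left (h x hx) (hη0 x)
    · have : η x = 0 := by
        rw [← Function.notMem_support, hη, (shrinkingBump a N).support_normed_eq]
        exact hx
      simp [this]
  · rw [integral_mul_const, hη1, one_mul]

/-- The mollification of `h` along the mollifier at `a`. -/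
theorem continuous_integral_sub_mul_mollifier {h : RSpace n → ℂ} (hh : Continuous h) :
    Continuous fun x => ∫ y, h (x - y) * mollifier a N y := by
  have := (hasCompactSupport_mollifier a N).continuous_convolution_left
    (ContinuousLinearMap.mul ℝ ℂ) (continuous_mollifier a N)
    (hh.locallyIntegrable (μ := volume))
  refine this.congr fun x => ?_
  simp only [convolution, ContinuousLinearMap.mul_apply', mul_comm]

end mollifier

open Filter Topology in
theorem eventually_one_div_lt {ρ : ℝ} (hρ : 0 < ρ) : ∀ᶠ N : ℕ in atTop, 1 / ((N : ℝ) + 1) < ρ :=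
  (tendsto_one_div_add_atTop_nhds_zero_nat (𝕜 := ℝ)).eventually_lt_const hρ

open Filter Topology in
theorem tendsto_integral_mollifier_mul {n : ℕ} (a : RSpace n) {g : RSpace n → ℂ}
    (hg : Continuous g) :
    Tendsto (fun N => ∫ x, mollifier a N x * g x) atTop (𝓝 (g a)) := by
  rw [Metric.tendsto_nhds]
  intro ε hε
  obtain ⟨ρ, hρ, h⟩ := Metric.continuousAt_iff.1 hg.continuousAt (ε / 2) (half_pos hε)
  filter_upwards [eventually_one_div_lt hρ] with N hN
  rw [dist_eq_norm]
  refine (norm_integral_mollifier_mul_sub_le a N hg fun x hx => ?_).trans_lt (half_lt_self hε)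
  rw [← dist_eq_norm]
  exact (h ((Metric.mem_ball.1 hx).trans hN)).le

open Filter Topology in
theorem tendsto_integral_mollifier_mul_integral {n : ℕ} (a b : RSpace n) {h : RSpace n → ℂ}
    (hh : Continuous h) :
    Tendsto (fun N => ∫ x, mollifier a N x * ∫ y, h (x - y) * mollifier b N y) atTop
      (𝓝 (h (a - b))) := by
  rw [Metric.tendsto_nhds]
  intro ε hε
  have hc : Continuous fun p : RSpace n × RSpace n => h (p.1 - p.2) :=
    hh.comp (continuous_fst.sub continuous_snd)
  obtain ⟨ρ, hρ, h1⟩ := Metric.continuousAt_iff.1 (hc.continuousAt (x := (a, b))) (ε / 2)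
    (half_pos hε)
  filter_upwards [eventually_one_div_lt hρ] with N hN
  rw [dist_eq_norm]
  refine (norm_integral_mollifier_mul_sub_le a N
    (continuous_integral_sub_mul_mollifier b N hh) fun x hx => ?_).trans_lt (half_lt_self hε)
  simp only [mul_comm (h _)]
  refine norm_integral_mollifier_mul_sub_le b N (hh.comp (continuous_const.sub continuous_id))
    fun y hy => ?_
  rw [← dist_eq_norm]
  refine (h1 (x := (x, y)) ?_).le
  rw [Prod.dist_eq]
  exact max_lt ((Metric.mem_ball.1 hx).trans hN) ((Metric.mem_ball.1 hy).trans hN)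

/-- Mollifiers are real, so conjugation reaches only the coefficients, and each entry of the double
sum converges to the matching entry of `gramForm`. -/
theorem energy_sum_mollifier {n : ℕ} {h : RSpace n → ℂ} (hh : Continuous h) {ι : Type*}
    [Fintype ι] (y : ι → RSpace n) (w : ι → ℂ) (N : ℕ) :
    energy h (fun x => ∑ i, w i * mollifier (y i) N x)
      = (∑ i, ∑ j, w i * conj (w j) * ∫ x, mollifier (y i) N x *
          ∫ z, h (x - z) * mollifier (y j) N z).re := by
  have hconj : ∀ a x, conj (mollifier (n := n) a N x) = mollifier a N x := fun a x =>
    Complex.conj_ofReal _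
  have hint : ∀ x j, Integrable fun z => h (x - z) * mollifier (y j) N z := fun x j => by
    simp only [mul_comm (h _)]
    exact integrable_mollifier_mul _ N (hh.comp (continuous_const.sub continuous_id))
  have hinner : ∀ x, ∫ z, h (x - z) * (∑ i, w i * mollifier (y i) N x)
        * conj (∑ i, w i * mollifier (y i) N z)
      = ∑ i, ∑ j, w i * conj (w j) * (mollifier (y i) N x *
          ∫ z, h (x - z) * mollifier (y j) N z) := by
    intro x
    have : ∀ z, h (x - z) * (∑ i, w i * mollifier (y i) N x)
        * conj (∑ i, w i * mollifier (y i) N z)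
        = ∑ j, ((∑ i, w i * mollifier (y i) N x) * conj (w j))
            * (h (x - z) * mollifier (y j) N z) := by
      intro z
      simp only [map_sum, map_mul, hconj]
      rw [Finset.mul_sum]
      exact Finset.sum_congr rfl fun j _ => by ring
    simp only [this]
    rw [integral_finsetSum _ fun j _ => (hint x j).const_mul _, Finset.sum_comm]
    refine Finset.sum_congr rfl fun j _ => ?_
    rw [integral_const_mul, Finset.sum_mul, Finset.sum_mul]
    exact Finset.sum_congr rfl fun i _ => by ring
  have hout : ∀ i j, Integrable fun x => w i * conj (w j) * (mollifier (y i) N x *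
      ∫ z, h (x - z) * mollifier (y j) N z) := fun i j =>
    (integrable_mollifier_mul _ N (continuous_integral_sub_mul_mollifier _ N hh)).const_mul _
  rw [energy]
  simp only [hinner]
  rw [integral_finsetSum _ fun i _ => integrable_finsetSum _ fun j _ => hout i j]
  congr 1
  refine Finset.sum_congr rfl fun i _ => ?_
  rw [integral_finsetSum _ fun j _ => hout i j]
  exact Finset.sum_congr rfl fun j _ => integral_const_mul _ _

theorem isTestFn_sum_mollifier {n : ℕ} {ι : Type*} [Fintype ι] (y : ι → RSpace n) (w : ι → ℂ)
    (N : ℕ) : IsTestFn 0 fun x => ∑ i, w i * mollifier (y i) N x := by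
  refine ⟨ContDiff.sum fun i _ => contDiff_const.mul (contDiff_mollifier _ N), ?_,
    fun _ h => absurd h (Nat.not_lt_zero _)⟩
  have hK : IsCompact (⋃ i, tsupport (mollifier (y i) N)) :=
    isCompact_iUnion fun i => hasCompactSupport_mollifier (y i) N
  refine HasCompactSupport.intro hK fun x hx => Finset.sum_eq_zero fun i _ => ?_
  have : x ∉ tsupport (mollifier (y i) N) := fun h => hx (Set.mem_iUnion.2 ⟨i, h⟩)
  rw [image_eq_zero_of_notMem_tsupport this, mul_zero]

open Filter Topology in
/-- The inequality that defines the native space extends from test functions to finite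
combinations of point masses. -/
theorem IsNativeBound.norm_sum_mul_le {n : ℕ} {h f : RSpace n → ℂ} {c : ℝ} (hh : Continuous h)
    (hf : Continuous f) (hc : IsNativeBound h 0 f c) {ι : Type*} [Fintype ι] (y : ι → RSpace n)
    (w : ι → ℂ) : ‖∑ i, w i * f (y i)‖ ≤ c * √(gramForm h y w).re := by
  have h1 : Tendsto (fun N => ∫ x, f x * ∑ i, w i * mollifier (y i) N x) atTop
      (𝓝 (∑ i, w i * f (y i))) := by
    have : ∀ N, ∫ x, f x * ∑ i, w i * mollifier (y i) N x
        = ∑ i, w i * ∫ x, mollifier (y i) N x * f x := by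
      intro N
      have : ∀ x, f x * ∑ i, w i * mollifier (y i) N x
          = ∑ i, w i * (mollifier (y i) N x * f x) := by
        intro x
        rw [Finset.mul_sum]
        exact Finset.sum_congr rfl fun i _ => by ring
      simp only [this]
      rw [integral_finsetSum _ fun i _ => (integrable_mollifier_mul _ N hf).const_mul _]
      exact Finset.sum_congr rfl fun i _ => integral_const_mul _ _
    simp only [this]
    exact tendsto_finsetSum _ fun i _ => (tendsto_integral_mollifier_mul _ hf).const_mul _
  have h2 : Tendsto (fun N => energy h fun x => ∑ i, w i * mollifier (y i) N x) atTop
      (𝓝 (gramForm h y w).re) := by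
    simp only [energy_sum_mollifier hh]
    refine (Complex.continuous_re.tendsto _).comp ?_
    exact tendsto_finsetSum _ fun i _ => tendsto_finsetSum _ fun j _ =>
      (tendsto_integral_mollifier_mul_integral _ _ hh).const_mul _
  exact le_of_tendsto_of_tendsto' h1.norm ((h2.sqrt).const_mul c)
    fun N => hc.2 _ (isTestFn_sum_mollifier y w N)

theorem norm_sum_mul_le_nativeNorm_mul {n : ℕ} {h f : RSpace n → ℂ} (hh : Continuous h)
    (hf : f ∈ nativeSpace h 0) {ι : Type*} [Fintype ι] (y : ι → RSpace n) (w : ι → ℂ) :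
    ‖∑ i, w i * f (y i)‖ ≤ nativeNorm h 0 f * √(gramForm h y w).re := by
  obtain ⟨c₀, hc₀⟩ := hf.2
  -- Passing to the infimum of the admissible constants requires division by the energy; at zero
  -- energy any one constant suffices.
  rcases (Real.sqrt_nonneg (gramForm h y w).re).eq_or_lt with h0 | h0
  · rw [← h0, mul_zero]
    have := hc₀.norm_sum_mul_le hh hf.1 y w
    rwa [← h0, mul_zero] at this
  · rw [← div_le_iff₀ h0]
    refine le_csInf ⟨c₀, hc₀⟩ fun c hc => ?_
    rw [div_le_iff₀ h0]
    exact IsNativeBound.norm_sum_mul_le hh hf.1 hc y w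

theorem nativeNorm_nonneg {n : ℕ} (h f : RSpace n → ℂ) (m : ℕ) : 0 ≤ nativeNorm h m f :=
  Real.sInf_nonneg fun _ hc => hc.1

/-! ### Positivity and Cauchy–Schwarz for the Gaussian kernel. -/

theorem continuous_gaussianFn (n : ℕ) (β : ℝ) : Continuous (gaussianFn n β) := by
  unfold gaussianFn
  fun_prop

theorem conj_gaussianFn {n : ℕ} (β : ℝ) (x : RSpace n) :
    conj (gaussianFn n β x) = gaussianFn n β x := Complex.conj_ofReal _

theorem gaussianFn_sub_comm {n : ℕ} (β : ℝ) (x y : RSpace n) :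
    gaussianFn n β (x - y) = gaussianFn n β (y - x) := by
  rw [gaussianFn, gaussianFn, norm_sub_rev]

/-- The Gaussian as a superposition of plane waves. -/
theorem exists_gaussianFn_eq_integral (n : ℕ) {β : ℝ} (hβ : 0 < β) :
    ∃ b K : ℝ, 0 < b ∧ 0 ≤ K ∧ ∀ x : RSpace n, gaussianFn n β x
      = K * ∫ v : RSpace n, Complex.exp (-(b : ℂ) * ‖v‖ ^ 2 + Complex.I * inner ℝ x v) := by
  refine ⟨1 / (4 * β), ((Real.pi / (1 / (4 * β))) ^ ((n : ℝ) / 2))⁻¹, by positivity, by positivity,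
    fun x => ?_⟩
  have hb : 0 < ((1 / (4 * β) : ℝ) : ℂ).re := by rw [Complex.ofReal_re]; positivity
  rw [GaussianFourier.integral_cexp_neg_mul_sq_norm_add hb Complex.I x, ← mul_assoc]
  have hpow : ((Real.pi : ℂ) / ((1 / (4 * β) : ℝ) : ℂ)) ^ ((Module.finrank ℝ (RSpace n) : ℂ) / 2)
      = (((Real.pi / (1 / (4 * β))) ^ ((n : ℝ) / 2) : ℝ) : ℂ) := by
    rw [Complex.ofReal_cpow (by positivity)]
    simp
  have hpos : (0 : ℝ) < (Real.pi / (1 / (4 * β))) ^ ((n : ℝ) / 2) := by positivity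
  rw [hpow, ← Complex.ofReal_mul, inv_mul_cancel₀ hpos.ne', Complex.ofReal_one, one_mul,
    gaussianFn, Complex.ofReal_exp]
  congr 1
  have hβ' : (β : ℂ) ≠ 0 := by exact_mod_cast hβ.ne'
  rw [Complex.I_sq]
  push_cast
  field_simp

/-- The Fourier representation turns the form into the integral of `|∑ wᵢ e^{i⟨yᵢ,v⟩}|²` against a
positive Gaussian weight. -/
theorem gramForm_gaussianFn_re_nonneg {n : ℕ} {β : ℝ} (hβ : 0 < β) {ι : Type*} [Fintype ι]
    (y : ι → RSpace n) (w : ι → ℂ) : 0 ≤ (gramForm (gaussianFn n β) y w).re := by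
  obtain ⟨b, K, hb, hK, hG⟩ := exists_gaussianFn_eq_integral n hβ
  have hint : ∀ x : RSpace n, Integrable fun v : RSpace n =>
      Complex.exp (-(b : ℂ) * ‖v‖ ^ 2 + Complex.I * inner ℝ x v) := fun x =>
    GaussianFourier.integrable_cexp_neg_mul_sq_norm_add (by simpa using hb) _ _
  have hsum : gramForm (gaussianFn n β) y w = K * ∫ v : RSpace n,
      ((Real.exp (-b * ‖v‖ ^ 2) * ‖∑ i, w i * Complex.exp (Complex.I * inner ℝ (y i) v)‖ ^ 2 : ℝ)
        : ℂ) := by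
    have : ∀ v : RSpace n,
        ((Real.exp (-b * ‖v‖ ^ 2) * ‖∑ i, w i * Complex.exp (Complex.I * inner ℝ (y i) v)‖ ^ 2
          : ℝ) : ℂ)
        = ∑ i, ∑ j, w i * conj (w j) *
          Complex.exp (-(b : ℂ) * ‖v‖ ^ 2 + Complex.I * inner ℝ (y i - y j) v) := by
      intro v
      rw [Complex.ofReal_mul, Complex.ofReal_pow, ← Complex.mul_conj', map_sum,
        Finset.sum_mul_sum, Finset.mul_sum]
      refine Finset.sum_congr rfl fun i _ => ?_
      rw [Finset.mul_sum]
      refine Finset.sum_congr rfl fun j _ => ?_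
      rw [map_mul, ← Complex.exp_conj, map_mul, Complex.conj_I, Complex.conj_ofReal,
        inner_sub_left, Complex.ofReal_exp, Complex.ofReal_sub, mul_sub, Complex.exp_add,
        sub_eq_add_neg, Complex.exp_add, neg_mul_eq_neg_mul Complex.I]
      push_cast
      ring
    simp only [this]
    rw [integral_finsetSum _ fun i _ => integrable_finsetSum _ fun j _ => (hint _).const_mul _,
      Finset.mul_sum, gramForm]
    refine Finset.sum_congr rfl fun i _ => ?_
    rw [integral_finsetSum _ fun j _ => (hint _).const_mul _, Finset.mul_sum]
    refine Finset.sum_congr rfl fun j _ => ?_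
    rw [integral_const_mul, hG]
    ring
  rw [hsum, integral_complex_ofReal, ← Complex.ofReal_mul, Complex.ofReal_re]
  exact mul_nonneg hK (integral_nonneg fun v => by positivity)

/-- The Cauchy–Schwarz inequality for the form of the Gaussian kernel. -/
theorem norm_sum_sum_gaussianFn_le {n : ℕ} {β : ℝ} (hβ : 0 < β) {ι κ : Type*} [Fintype ι]
    [Fintype κ] (y : ι → RSpace n) (w : ι → ℂ) (z : κ → RSpace n) (v : κ → ℂ) :
    ‖∑ i, ∑ j, w i * conj (v j) * gaussianFn n β (y i - z j)‖
      ≤ √(gramForm (gaussianFn n β) y w).re * √(gramForm (gaussianFn n β) z v).re := by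
  set X := ∑ i, ∑ j, w i * conj (v j) * gaussianFn n β (y i - z j) with hX
  set A := (gramForm (gaussianFn n β) y w).re with hA
  set B := (gramForm (gaussianFn n β) z v).re with hB
  have hexp : ∀ t : ℂ, gramForm (gaussianFn n β) (Sum.elim y z) (Sum.elim w fun j => t * v j)
      = gramForm (gaussianFn n β) y w + conj t * X + t * conj X
        + t * conj t * gramForm (gaussianFn n β) z v := by
    intro t
    have h1 : conj t * X = ∑ i, ∑ j, w i * conj (t * v j) * gaussianFn n β (y i - z j) := by
      rw [hX, Finset.mul_sum]
      refine Finset.sum_congr rfl fun i _ => ?_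
      rw [Finset.mul_sum]
      exact Finset.sum_congr rfl fun j _ => by rw [map_mul]; ring
    have h2 : t * conj X = ∑ j, ∑ i, t * v j * conj (w i) * gaussianFn n β (z j - y i) := by
      rw [hX, map_sum, Finset.sum_comm, Finset.mul_sum]
      refine Finset.sum_congr rfl fun i _ => ?_
      rw [map_sum, Finset.mul_sum]
      refine Finset.sum_congr rfl fun j _ => ?_
      rw [map_mul, map_mul, conj_gaussianFn, gaussianFn_sub_comm, Complex.conj_conj]
      ring
    have h3 : t * conj t * gramForm (gaussianFn n β) z v
        = ∑ i, ∑ j, t * v i * conj (t * v j) * gaussianFn n β (z i - z j) := by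
      rw [gramForm, Finset.mul_sum]
      refine Finset.sum_congr rfl fun i _ => ?_
      rw [Finset.mul_sum]
      exact Finset.sum_congr rfl fun j _ => by rw [map_mul]; ring
    rw [h1, h2, h3]
    simp only [gramForm, Fintype.sum_sum_type, Sum.elim_inl, Sum.elim_inr,
      Finset.sum_add_distrib]
    ring
  -- Positivity of the form on the joint system with `t = -s X`; this phase makes both cross terms
  -- real.
  have hquad : ∀ s : ℝ, 0 ≤ ‖X‖ ^ 2 * B * (s * s) + -2 * ‖X‖ ^ 2 * s + A := by
    intro s
    have h := gramForm_gaussianFn_re_nonneg hβ (Sum.elim y z)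
      (Sum.elim w fun j => (-s * X : ℂ) * v j)
    rw [hexp] at h
    have hXX : X * conj X = ((‖X‖ ^ 2 : ℝ) : ℂ) := by
      rw [Complex.mul_conj']; push_cast; rfl
    have h1 : conj (-s * X : ℂ) * X = ((-s * ‖X‖ ^ 2 : ℝ) : ℂ) := by
      rw [map_mul, map_neg, Complex.conj_ofReal, mul_assoc, mul_comm (conj X), hXX]
      push_cast; ring
    have h2 : (-s * X : ℂ) * conj X = ((-s * ‖X‖ ^ 2 : ℝ) : ℂ) := by
      rw [mul_assoc, hXX]; push_cast; ring
    have h3 : (-s * X : ℂ) * conj (-s * X : ℂ) = ((s * s * ‖X‖ ^ 2 : ℝ) : ℂ) := by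
      rw [map_mul, map_neg, Complex.conj_ofReal, mul_mul_mul_comm, hXX]
      push_cast; ring
    rw [h1, h2, h3] at h
    simp only [Complex.add_re, Complex.ofReal_re, Complex.re_ofReal_mul] at h
    rw [← hA, ← hB] at h
    linarith
  have hd := discrim_le_zero hquad
  rw [discrim] at hd
  have hA0 : 0 ≤ A := gramForm_gaussianFn_re_nonneg hβ y w
  rcases (norm_nonneg X).eq_or_lt with h0 | h0
  · rw [← h0]; positivity
  · rw [← Real.sqrt_mul hA0]
    refine Real.le_sqrt_of_sq_le ?_
    have h4 : 0 < ‖X‖ ^ 2 := by positivity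
    have h5 : ‖X‖ ^ 2 * (‖X‖ ^ 2) ≤ ‖X‖ ^ 2 * (A * B) := by nlinarith
    exact le_of_mul_le_mul_left h5 h4

/-! ### Stability of splines. -/

/-- Interpolating splines are at most as large as the interpolated function, when tested against
finite combinations of point masses. -/
theorem IsSplineInterpolant.norm_sum_mul_le {n : ℕ} {β : ℝ} (hβ : 0 < β) {f s : RSpace n → ℂ}
    {X : Set (RSpace n)} (hf : f ∈ nativeSpace (gaussianFn n β) 0)
    (hs : IsSplineInterpolant (gaussianFn n β) 0 f X s) {ι : Type*} [Fintype ι]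
    (y : ι → RSpace n) (w : ι → ℂ) :
    ‖∑ i, w i * s (y i)‖
      ≤ nativeNorm (gaussianFn n β) 0 f * √(gramForm (gaussianFn n β) y w).re := by
  have hh := continuous_gaussianFn n β
  rcases hs with ⟨hs, -, hmin⟩ | ⟨N, p, c, hN, hp, -, hsp, hsf⟩
  · exact (norm_sum_mul_le_nativeNorm_mul hh hs y w).trans
      (mul_le_mul_of_nonneg_right (hmin f hf fun _ _ => rfl) (Real.sqrt_nonneg _))
  · have hp0 : p = 0 := by
      rw [← MvPolynomial.support_eq_empty, Finset.eq_empty_iff_forall_notMem]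
      exact fun d hd => Nat.not_lt_zero _ (hp d hd)
    have hs' : ∀ x, s x = ∑ a : N, conj (conj (c a)) * gaussianFn n β (x - a) := by
      intro x
      rw [hsp, hp0, polyEval, map_zero, zero_add, ← Finset.sum_coe_sort]
      simp
    have hsum : ∑ i, w i * s (y i)
        = ∑ i, ∑ a : N, w i * conj (conj (c a)) * gaussianFn n β (y i - a) := by
      refine Finset.sum_congr rfl fun i _ => ?_
      rw [hs', Finset.mul_sum]
      exact Finset.sum_congr rfl fun a _ => by ring
    set Q := gramForm (gaussianFn n β) (fun a : N => (a : RSpace n)) (fun a => conj (c a)) with hQ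
    have hQs : Q = ∑ a : N, conj (c a) * f a := by
      rw [hQ, gramForm]
      refine Finset.sum_congr rfl fun a _ => ?_
      rw [← hsf (hN ▸ a.2), hs', Finset.mul_sum]
      exact Finset.sum_congr rfl fun b _ => by ring
    have hQ0 : 0 ≤ Q.re := gramForm_gaussianFn_re_nonneg hβ _ _
    -- As `s = f` on `X`, the energy `Q` of the spline is a pairing of `f` with its own point
    -- masses. Dividing by `√Q` bounds the size of the spline by that of `f`, with no appeal to
    -- minimality.
    have h1 : Q.re ≤ nativeNorm (gaussianFn n β) 0 f * √Q.re := by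
      refine (Complex.re_le_norm Q).trans ?_
      nth_rw 1 [hQs]
      exact norm_sum_mul_le_nativeNorm_mul hh hf _ _
    have h2 : √Q.re ≤ nativeNorm (gaussianFn n β) 0 f := by
      rcases (Real.sqrt_nonneg Q.re).eq_or_lt with h0 | h0
      · rw [← h0]; exact nativeNorm_nonneg _ _ _
      · refine le_of_mul_le_mul_right ?_ h0
        rwa [Real.mul_self_sqrt hQ0]
    rw [hsum, mul_comm]
    exact (norm_sum_sum_gaussianFn_le hβ y w _ _).trans
      (mul_le_mul_of_nonneg_left h2 (Real.sqrt_nonneg _))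

/-! ### The constants and the choice of degree. -/

theorem one_le_two_mul_sqrt_three_div_exp : 1 ≤ 2 * (√3 / Real.exp 1) := by
  have h1 : (1.7 : ℝ) ≤ √3 := Real.le_sqrt_of_sq_le (by norm_num)
  have h2 := Real.exp_one_lt_d9
  rw [← mul_div_assoc, one_le_div (Real.exp_pos 1)]
  linarith

theorem inv_sqrt_pow_le_ballVolume {n : ℕ} (hn : 1 ≤ n) : (1 / √(n : ℝ)) ^ n ≤ ballVolume n := by
  have : Nonempty (Fin n) := ⟨⟨0, hn⟩⟩
  have hΓ0 : 0 < Real.Gamma ((n : ℝ) / 2 + 1) := Real.Gamma_pos_of_pos (by positivity)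
  rw [ballVolume, EuclideanSpace.volume_ball, Fintype.card_fin, ENNReal.ofReal_one, one_pow,
    one_mul, ENNReal.toReal_ofReal (by positivity)]
  have hn' : (1 : ℝ) ≤ n := by exact_mod_cast hn
  -- Log-convexity of `Γ` at the midpoint of 1 and `n + 1` gives the bound `√(n!)`.
  have hΓ : Real.Gamma ((n : ℝ) / 2 + 1) ≤ √(n : ℝ) ^ n := by
    have h1 := Real.Gamma_mul_add_mul_le_rpow_Gamma_mul_rpow_Gamma (s := (n : ℝ) + 1) (t := 1)
      (a := 1 / 2) (b := 1 / 2) (by positivity) one_pos (by norm_num) (by norm_num) (by norm_num)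
    rw [Real.Gamma_one, Real.one_rpow, Real.Gamma_nat_eq_factorial,
      ← Real.sqrt_eq_rpow] at h1
    rw [show (n : ℝ) / 2 + 1 = 1 / 2 * ((n : ℝ) + 1) + 1 / 2 * 1 by ring]
    refine (h1.trans_eq (mul_one _)).trans (Real.sqrt_le_iff.2 ⟨by positivity, ?_⟩)
    rw [← pow_mul, mul_comm n 2, pow_mul, Real.sq_sqrt (by positivity)]
    exact_mod_cast Nat.factorial_le_pow n
  have hπ : (1 : ℝ) ≤ √Real.pi ^ n :=
    one_le_pow₀ (Real.one_le_sqrt.2 (by linarith [Real.pi_gt_three]))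
  rw [one_div, inv_pow, ← one_div]
  exact div_le_div₀ (by positivity) hπ hΓ0 hΓ

/-- All factors besides `(n αₙ)^{1/2}` combine to at least 1, because `π ≥ 1` and `2ρ ≥ 1`. Nothing
more about `Δ''` enters the error estimate. -/
theorem deltaConst_lower {n : ℕ} (hn : 1 ≤ n) :
    0 < deltaConst n ∧ (1 / √(n : ℝ)) ^ n ≤ deltaConst n ^ 2 := by
  have hn' : (1 : ℝ) ≤ n := by exact_mod_cast hn
  have hα := inv_sqrt_pow_le_ballVolume hn
  have hpos : 0 < (1 / √(n : ℝ)) ^ n := by positivity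
  have hα0 : 0 < ballVolume n := hpos.trans_le hα
  have hρ := one_le_two_mul_sqrt_three_div_exp
  set ρ := √3 / Real.exp 1 with hρdef
  have hρ0 : 0 < ρ := by positivity
  have hπ : 1 ≤ Real.pi ^ (((n : ℝ) - 1) / 4) :=
    Real.one_le_rpow (by linarith [Real.pi_gt_three]) (by linarith)
  have hV0 : 0 < (n * ballVolume n) ^ ((1 : ℝ) / 2) := by positivity
  have main : (n * ballVolume n) ^ ((1 : ℝ) / 2) ≤ deltaConst n := by
    rw [deltaConst]
    split_ifs with he
    · have h2n : (2 : ℝ) ≤ n := by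
        obtain ⟨m, rfl⟩ := he
        have : 1 ≤ m := by omega
        exact_mod_cast (by omega : 2 ≤ m + m)
      have h1 : 1 ≤ 2 ^ (((n : ℝ) + 1) / 4) * ρ ^ (((n : ℝ) - 2) / 4) := by
        rw [show ((n : ℝ) + 1) / 4 = 3 / 4 + ((n : ℝ) - 2) / 4 by ring,
          Real.rpow_add two_pos, mul_assoc, ← Real.mul_rpow two_pos.le hρ0.le]
        exact one_le_mul_of_one_le_of_one_le (Real.one_le_rpow one_le_two (by norm_num))
          (Real.one_le_rpow hρ (by linarith))
      rw [mul_assoc, mul_right_comm]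
      exact le_mul_of_one_le_left hV0.le (one_le_mul_of_one_le_of_one_le hπ h1)
    · have h1 : 1 ≤ 2 ^ ((n : ℝ) / 4) * ρ ^ (((n : ℝ) - 1) / 4) := by
        rw [show (n : ℝ) / 4 = 1 / 4 + ((n : ℝ) - 1) / 4 by ring,
          Real.rpow_add two_pos, mul_assoc, ← Real.mul_rpow two_pos.le hρ0.le]
        exact one_le_mul_of_one_le_of_one_le (Real.one_le_rpow one_le_two (by norm_num))
          (Real.one_le_rpow hρ (by linarith))
      have h2 : 1 ≤ (2 + 1 / Real.exp 1) ^ ((1 : ℝ) / 2) :=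
        Real.one_le_rpow (by linarith [one_div_pos.2 (Real.exp_pos 1)]) (by norm_num)
      refine (le_mul_of_one_le_right hV0.le (one_le_mul_of_one_le_of_one_le hπ
        (one_le_mul_of_one_le_of_one_le h2 h1))).trans_eq ?_
      ring
  refine ⟨hV0.trans_le main, ?_⟩
  calc (1 / √(n : ℝ)) ^ n ≤ ballVolume n := hα
    _ ≤ n * ballVolume n := le_mul_of_one_le_left hα0.le hn'
    _ = ((n * ballVolume n) ^ ((1 : ℝ) / 2)) ^ 2 := by
        rw [← Real.sqrt_eq_rpow, Real.sq_sqrt (by positivity)]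
    _ ≤ deltaConst n ^ 2 := pow_le_pow_left₀ hV0.le main 2

theorem gammaSeq_pos {n : ℕ} (hn : 1 ≤ n) : 0 < gammaSeq n := by
  obtain ⟨n, rfl⟩ := Nat.exists_eq_add_of_le' hn
  linarith [two_le_gammaSeq n]

/-- This form exposes `√C`, the quantity that appears in the energy estimate; `27 · 12 = 18²`. -/
theorem bigC_eq (n : ℕ) {β b₀ : ℝ} (hβ : 0 < β) :
    bigC n β b₀ = (18 * Real.exp 1 * (β * n) * Real.exp (4 * n * gammaSeq n)) ^ 2
      * (b₀ ^ 3 * gammaSeq n) := by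
  have h1 : ((3 : ℝ) ^ ((3 : ℝ) / 4)) ^ 4 = 27 := by
    rw [← Real.rpow_natCast, ← Real.rpow_mul (by norm_num)]
    norm_num
  have h2 : √(2 * rhoConst * β) ^ 4 = 12 * β ^ 2 / Real.exp 1 ^ 2 := by
    have h0 : 0 ≤ 2 * rhoConst * β := by rw [rhoConst]; positivity
    rw [show 4 = 2 * 2 by norm_num, pow_mul, Real.sq_sqrt h0, rhoConst]
    have : √(3 : ℝ) ^ 2 = 3 := Real.sq_sqrt (by norm_num)
    rw [mul_pow, mul_pow, div_pow, this]
    ring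
  have h3 : √(n : ℝ) ^ 4 = (n : ℝ) ^ 2 := by
    rw [show 4 = 2 * 2 by norm_num, pow_mul, Real.sq_sqrt n.cast_nonneg]
  have h4 : Real.exp (2 * n * gammaSeq n) ^ 4 = Real.exp (4 * n * gammaSeq n) ^ 2 := by
    rw [← Real.exp_nat_mul, ← Real.exp_nat_mul]
    push_cast
    ring_nf
  have he := Real.exp_pos 1
  rw [bigC, mul_pow, mul_pow, mul_pow, mul_pow, h1, h2, h3, h4]
  field_simp
  ring

theorem bigC_pos {n : ℕ} (hn : 1 ≤ n) {β b₀ : ℝ} (hβ : 0 < β) (hb₀ : 0 < b₀) :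
    0 < bigC n β b₀ := by
  have := gammaSeq_pos hn
  rw [bigC_eq n hβ]
  positivity

theorem deltaZero_eq (n : ℕ) (β b₀ : ℝ) :
    deltaZero n β b₀ = min (1 / bigC n β b₀) (deltaN n b₀) := rfl

theorem deltaN_pos {n : ℕ} (hn : 1 ≤ n) {b₀ : ℝ} (hb₀ : 0 < b₀) : 0 < deltaN n b₀ := by
  have hγ : (0 : ℝ) < gammaSeq n := by exact_mod_cast gammaSeq_pos hn
  rw [deltaN]
  split_ifs with h1 h2
  · positivity
  · have : (1 : ℝ) < n := by exact_mod_cast (by omega : 1 < n)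
    have : (0 : ℝ) < n - 1 := by linarith
    positivity
  · have : (2 : ℝ) < n := by exact_mod_cast (by omega : 2 < n)
    have : (0 : ℝ) < n - 2 := by linarith
    positivity

/-- The condition on `δ` leaves room for polynomials of degree at least `max 2 n`. -/
theorem le_div_of_le_deltaN {n : ℕ} (hn : 1 ≤ n) {b₀ δ : ℝ} (hδ : 0 < δ) (hδn : δ ≤ deltaN n b₀) :
    2 ≤ b₀ / (gammaSeq n * δ) ∧ (n : ℝ) ≤ b₀ / (gammaSeq n * δ) := by
  have hγ : (0 : ℝ) < gammaSeq n := by exact_mod_cast gammaSeq_pos hn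
  have hγδ : 0 < gammaSeq n * δ := by positivity
  rw [le_div_iff₀ hγδ, le_div_iff₀ hγδ]
  rw [deltaN] at hδn
  split_ifs at hδn with h1 h2
  · rw [le_div_iff₀ (by positivity)] at hδn
    have h3 : (n : ℝ) ≤ 2 := by exact_mod_cast (by omega : n ≤ 2)
    constructor <;> nlinarith
  · have h3 : (3 : ℝ) ≤ n := by exact_mod_cast (by omega : 3 ≤ n)
    rw [le_div_iff₀ (by have : (0 : ℝ) < n - 1 := by linarith
                        positivity)] at hδn
    constructor <;> nlinarith
  · have h3 : (4 : ℝ) ≤ n := by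
      have : n ≠ 3 := by rintro rfl; exact h2 (by decide)
      exact_mod_cast (by omega : 4 ≤ n)
    rw [le_div_iff₀ (by have : (0 : ℝ) < n - 2 := by linarith
                        positivity)] at hδn
    constructor <;> nlinarith

/-- The degree `k` for which polynomial approximation on a cube of side `γₙ k δ` gives the
asserted rate. -/
theorem exists_degree {n : ℕ} (hn : 1 ≤ n) {β b₀ δ : ℝ} (hβ : 0 < β) (hb₀ : 0 < b₀) (hδ : 0 < δ)
    (hδ₀ : δ ≤ deltaZero n β b₀) :
    ∃ k : ℕ, 1 ≤ k ∧ ((gammaSeq n * k : ℕ) : ℝ) * δ ≤ b₀ ∧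
      2 * (β * δ ^ 2) * (n * ((gammaSeq n * k : ℕ) : ℝ) ^ 2) ≤ (k + 1) / 2 ∧
      2 * √(Real.exp (2 * n * gammaSeq n * k) ^ 2 *
          ((2 * (β * δ ^ 2) * (n * ((gammaSeq n * k : ℕ) : ℝ) ^ 2)) ^ k / k.factorial * 2))
        ≤ deltaConst n * (bigC n β b₀ * δ) ^ (smallC n b₀ / δ) := by
  have hγ : (0 : ℝ) < gammaSeq n := by exact_mod_cast gammaSeq_pos hn
  have hn' : (1 : ℝ) ≤ n := by exact_mod_cast hn
  have hC := bigC_pos hn hβ hb₀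
  rw [deltaZero_eq] at hδ₀
  have hU1 : bigC n β b₀ * δ ≤ 1 := by
    have := hδ₀.trans (min_le_left _ _)
    rwa [le_div_iff₀ hC, mul_comm] at this
  have hU0 : 0 < bigC n β b₀ * δ := by positivity
  obtain ⟨hx2, hxn⟩ := le_div_of_le_deltaN hn hδ (hδ₀.trans (min_le_right _ _))
  set X := b₀ / (gammaSeq n * δ) with hX
  set k := ⌊X⌋₊ with hkdef
  have hk2 : 2 ≤ k := Nat.le_floor (by exact_mod_cast hx2)
  have hkn : n ≤ k := Nat.le_floor hxn
  have hkX : (k : ℝ) ≤ X := Nat.floor_le (by positivity)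
  -- Rounding down costs at most half, because `X ≥ 2`.
  have hXk : X / 2 ≤ k := by
    have := Nat.lt_floor_add_one X
    rw [← hkdef] at this
    linarith
  have hk2' : (2 : ℝ) ≤ k := by exact_mod_cast hk2
  have hk0 : (0 : ℝ) < k := by linarith
  have hkn' : (n : ℝ) ≤ k := by exact_mod_cast hkn
  have hl : ((gammaSeq n * k : ℕ) : ℝ) * δ ≤ b₀ := by
    rw [hX, le_div_iff₀ (by positivity)] at hkX
    push_cast
    linarith
  set l := ((gammaSeq n * k : ℕ) : ℝ) * δ with hldef
  have hl0 : 0 ≤ l := by positivity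
  have hlk : l = gammaSeq n * k * δ := by rw [hldef]; push_cast; ring
  set t := 2 * (β * δ ^ 2) * (n * ((gammaSeq n * k : ℕ) : ℝ) ^ 2) with ht
  have htl : t = 2 * (β * n) * l ^ 2 := by rw [ht, hldef]; ring
  have ht0 : 0 ≤ t := by positivity
  set E := Real.exp (4 * n * gammaSeq n) with hE
  have hE1 : 1 ≤ E := Real.one_le_exp (by positivity)
  set e := Real.exp 1 with he
  have he1 : 1 ≤ e := Real.one_le_exp zero_le_one
  set U := bigC n β b₀ * δ with hU
  have hsU : √U = 18 * e * (β * n) * E * √(b₀ ^ 3 * gammaSeq n * δ) := by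
    rw [hU, bigC_eq n hβ, mul_assoc, Real.sqrt_mul (by positivity), Real.sqrt_sq (by positivity)]
  have hsU1 : √U ≤ 1 := Real.sqrt_le_one.2 hU1
  -- Of the four factors in `l ^ 4`, three are bounded by `b₀` and one is kept as `γₙ k δ`. The
  -- factor `√k` is later outweighed by `k!`, and the rest is the source of `b₀³ γₙ δ` in `C δ`.
  have hl2 : l ^ 2 ≤ √k * √(b₀ ^ 3 * gammaSeq n * δ) := by
    rw [← Real.sqrt_mul hk0.le]
    refine Real.le_sqrt_of_sq_le ?_
    calc (l ^ 2) ^ 2 = l ^ 3 * l := by ring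
      _ ≤ b₀ ^ 3 * l := mul_le_mul_of_nonneg_right (pow_le_pow_left₀ hl0 hl 3) hl0
      _ = k * (b₀ ^ 3 * gammaSeq n * δ) := by rw [hlk]; ring
  have htE : E * t ≤ √k * √U / (9 * e) := by
    rw [le_div_iff₀ (by positivity), hsU, htl]
    have := mul_le_mul_of_nonneg_left hl2 (by positivity : 0 ≤ 18 * e * (β * n) * E)
    linarith
  have hsk : √(k : ℝ) ≤ k := Real.sqrt_le_iff.2 ⟨hk0.le, by nlinarith⟩
  refine ⟨k, by omega, hl, ?_, ?_⟩
  · have h1 : t ≤ E * t := le_mul_of_one_le_left ht0 hE1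
    have h2 : √k * √U / (9 * e) ≤ k / 9 := by
      have h3 : √k * √U ≤ k := by
        have := mul_le_mul hsk hsU1 (Real.sqrt_nonneg _) hk0.le
        linarith
      exact div_le_div₀ hk0.le h3 (by norm_num) (by linarith)
    linarith
  · obtain ⟨hΔ0, hΔ⟩ := deltaConst_lower hn
    have hrhs0 : 0 ≤ deltaConst n * U ^ (smallC n b₀ / δ) := by positivity
    have hexp : Real.exp (2 * n * gammaSeq n * k) ^ 2 = E ^ k := by
      rw [hE, ← Real.exp_nat_mul, ← Real.exp_nat_mul]
      push_cast
      ring_nf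
    have hfac : (1 : ℝ) / k.factorial ≤ (e / k) ^ k := by
      have h1 := Real.pow_div_factorial_le_exp (k : ℝ) hk0.le k
      have h2 : Real.exp k = e ^ k := by rw [he, ← Real.exp_nat_mul, mul_one]
      rw [h2, div_eq_mul_one_div] at h1
      rw [div_pow, le_div_iff₀ (by positivity), mul_comm]
      exact h1
    -- Exponents compare as `k / 2 ≥ X / 4 = 2 c / δ`, and `U ≤ 1`.
    have hUk : √U ^ k ≤ (U ^ (smallC n b₀ / δ)) ^ 2 := by
      rw [Real.sqrt_eq_rpow, ← Real.rpow_natCast, ← Real.rpow_natCast, ← Real.rpow_mul hU0.le,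
        ← Real.rpow_mul hU0.le]
      refine Real.rpow_le_rpow_of_exponent_ge hU0 hU1 ?_
      have : smallC n b₀ / δ = X / 8 := by rw [smallC, hX]; field_simp
      rw [this]
      push_cast
      linarith
    -- Uses `n ≤ k`; what is left of `1 / k!` is absorbed into `Δ''` this way.
    have hkk : (1 / √(k : ℝ)) ^ k ≤ (1 / √(n : ℝ)) ^ n := by
      have h1 : (1 : ℝ) ≤ √(n : ℝ) := Real.one_le_sqrt.2 hn'
      have h2 : √(n : ℝ) ≤ √(k : ℝ) := Real.sqrt_le_sqrt hkn'
      rw [one_div_pow, one_div_pow]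
      refine one_div_le_one_div_of_le (by positivity) ?_
      exact (pow_le_pow_left₀ (by positivity) h2 n).trans
        (pow_le_pow_right₀ (h1.trans h2) hkn)
    have h9 : (8 : ℝ) * (1 / 9) ^ k ≤ 1 := by
      have : ((1 : ℝ) / 9) ^ k ≤ (1 / 9) ^ 1 :=
        pow_le_pow_of_le_one (by norm_num) (by norm_num) (by omega)
      linarith
    rw [hexp]
    refine (pow_le_pow_iff_left₀ (by positivity) hrhs0 two_ne_zero).1 ?_
    rw [mul_pow, Real.sq_sqrt (by positivity)]
    calc 2 ^ 2 * (E ^ k * (t ^ k / k.factorial * 2))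
        = 8 * ((E * t) ^ k * (1 / k.factorial)) := by rw [mul_pow]; ring
      _ ≤ 8 * ((√k * √U / (9 * e)) ^ k * (e / k) ^ k) := by gcongr
      _ = 8 * (1 / 9) ^ k * ((1 / √k) ^ k * √U ^ k) := by
          have : √(k : ℝ) * √U / (9 * e) * (e / k) = 1 / 9 * (1 / √k * √U) := by
            have hs := Real.mul_self_sqrt hk0.le
            have hs0 : 0 < √(k : ℝ) := Real.sqrt_pos.2 hk0
            nth_rw 2 [← hs]
            field_simp
          rw [← mul_pow, this, mul_pow, mul_pow]
          ring
      _ ≤ 1 * (deltaConst n ^ 2 * (U ^ (smallC n b₀ / δ)) ^ 2) := by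
          gcongr
          exact hkk.trans hΔ
      _ = (deltaConst n * U ^ (smallC n b₀ / δ)) ^ 2 := by ring

/-! ### The error estimate. -/

theorem IsSplineInterpolant.eqOn {n m : ℕ} {h f s : RSpace n → ℂ} {X : Set (RSpace n)}
    (hs : IsSplineInterpolant h m f X s) : Set.EqOn s f X := by
  rcases hs with ⟨-, hs, -⟩ | ⟨N, p, c, -, -, -, -, hs⟩ <;> exact hs

/-- Parseval in the basis `u`: translations cancel in differences, and rescaling by `δ` turns `β`
into `β δ²`. -/
theorem gramForm_gaussianFn_ofReal {n : ℕ} (β δ : ℝ) (hδ : 0 < δ)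
    (u : OrthonormalBasis (Fin n) ℝ (RSpace n)) (a : RSpace n) (r : Fin n → ℝ) {ι : Type*}
    [Fintype ι] (y : ι → RSpace n) (v : ι → ℝ) :
    (gramForm (gaussianFn n β) y fun i => (v i : ℂ)).re
      = ∑ i, ∑ j, v i * v j * Real.exp (-(β * δ ^ 2) *
          ∑ l, ((inner ℝ (u l) (y i - a) - r l) / δ - (inner ℝ (u l) (y j - a) - r l) / δ) ^ 2) := by
  rw [gramForm, Complex.re_sum]
  refine Finset.sum_congr rfl fun i _ => ?_
  rw [Complex.re_sum]
  refine Finset.sum_congr rfl fun j _ => ?_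
  rw [Complex.conj_ofReal, gaussianFn, ← Complex.ofReal_mul, ← Complex.ofReal_mul,
    Complex.ofReal_re, ← u.sum_sq_inner_right (y i - y j), neg_mul, neg_mul, mul_assoc β,
    Finset.mul_sum (a := δ ^ 2)]
  congr 4
  refine Finset.sum_congr rfl fun l _ => ?_
  rw [← sub_div, div_pow, mul_div_cancel₀ _ (by positivity), sub_sub_sub_cancel_right,
    ← inner_sub_right, sub_sub_sub_cancel_right]

/-- Interpolation error at `x` in terms of a cube of side `γₙ k δ` that contains `x`. -/
theorem IsSplineInterpolant.interpolationError_le {n k : ℕ} (hn : 1 ≤ n) (hk : 1 ≤ k) {β b δ : ℝ}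
    (hβ : 0 < β) (hδ : 0 < δ) (hkb : ((gammaSeq n * k : ℕ) : ℝ) * δ ≤ b)
    (hsmall : 2 * (β * δ ^ 2) * (n * ((gammaSeq n * k : ℕ) : ℝ) ^ 2) ≤ (k + 1) / 2)
    {f s : RSpace n → ℂ} {X : Set (RSpace n)} (hf : f ∈ nativeSpace (gaussianFn n β) 0)
    (hs : IsSplineInterpolant (gaussianFn n β) 0 f X s)
    (u : OrthonormalBasis (Fin n) ℝ (RSpace n)) (a : RSpace n)
    (hX : ∀ a' : RSpace n, cube u a' δ ⊆ cube u a b → (cube u a' δ ∩ X).Nonempty)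
    {x : RSpace n} (hx : x ∈ cube u a b) :
    ‖f x - s x‖ ≤ 2 * √(Real.exp (2 * n * gammaSeq n * k) ^ 2 *
        ((2 * (β * δ ^ 2) * (n * ((gammaSeq n * k : ℕ) : ℝ) ^ 2)) ^ k / k.factorial * 2))
      * nativeNorm (gaussianFn n β) 0 f := by
  have hb : 0 < β * δ ^ 2 := by positivity
  set q := gammaSeq n * k with hq
  -- Lower corner of a subcube of side `q δ` that contains `x`: it starts at `x` unless it must be
  -- slid back to stay inside the big cube.
  set r : Fin n → ℝ := fun i => min (inner ℝ (u i) (x - a)) (b - q * δ) with hr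
  have hr0 : ∀ i, 0 ≤ r i := fun i => le_min (hx i).1 (sub_nonneg.2 hkb)
  have hrb : ∀ i, r i ≤ b - q * δ := fun i => min_le_right _ _
  set ζ : RSpace n → Fin n → ℝ := fun y l => (inner ℝ (u l) (y - a) - r l) / δ with hζ
  have hζx : ∀ i, ζ x i ∈ Set.Icc (0 : ℝ) (q : ℝ) := by
    intro i
    have h1 : r i ≤ inner ℝ (u i) (x - a) := min_le_left _ _
    refine ⟨div_nonneg (sub_nonneg.2 h1) hδ.le, ?_⟩
    rw [hζ, div_le_iff₀ hδ, sub_le_iff_le_add']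
    have h2 := (hx i).2
    simp only [hr]
    rcases min_cases (inner ℝ (u i) (x - a)) (b - q * δ) with h | h
    · rw [h.1]; linarith [(by positivity : 0 ≤ (q : ℝ) * δ)]
    · rw [h.1]; linarith
  have hcell : ∀ c : Fin n → Fin q, ∃ y ∈ X, ζ y ∈ gridCell c := by
    intro c
    -- The corner of the subcube of side `δ` that becomes the grid cell `c` in the coordinates `ζ`.
    let a' : RSpace n := a + ∑ i, (r i + δ * (c i : ℕ)) • u i
    have ha' : ∀ y i, inner ℝ (u i) (y - a) = inner ℝ (u i) (y - a') + (r i + δ * (c i : ℕ)) := by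
      intro y i
      have h1 : y - a = (y - a') + ∑ i, (r i + δ * (c i : ℕ)) • u i := by
        simp only [a']; abel
      rw [h1, inner_add_right, u.orthonormal.inner_right_fintype]
    obtain ⟨y, hy, hyX⟩ := hX a' (by
      intro y hy i
      have h1 := hy i
      have h2 : (((c i : ℕ) : ℝ)) + 1 ≤ q := by exact_mod_cast (c i).2
      have h3 := mul_le_mul_of_nonneg_left h2 hδ.le
      have h4 : 0 ≤ δ * ((c i : ℕ) : ℝ) := by positivity
      rw [ha']
      constructor
      · linarith [h1.1, hr0 i]
      · linarith [h1.2, hrb i])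
    refine ⟨y, hyX, fun i => ?_, fun i => ?_⟩
    · have h1 := (hy i).1
      simp only [hζ]
      rw [le_div_iff₀ hδ, ha']
      linarith
    · have h1 := (hy i).2
      simp only [hζ]
      rw [div_le_iff₀ hδ, ha']
      linarith
  choose Y hYX hYc using hcell
  obtain ⟨v, hv1, hv2⟩ := exists_gaussian_weights hn hk hb.le hsmall (y := fun c => ζ (Y c)) hYc hζx
  let P : Option (Fin n → Fin q) → RSpace n := fun o => o.elim x Y
  have hgram := (gramForm_gaussianFn_ofReal β δ hδ u a r P v).trans_le
    (le_of_eq_of_le (Finset.sum_congr rfl fun o _ => Finset.sum_congr rfl fun o' _ => by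
      rcases o with _ | c <;> rcases o' with _ | c' <;> rfl) hv2)
  have hsqrt := Real.sqrt_le_sqrt hgram
  have hdiff : f x - s x = ∑ o, (v o : ℂ) * f (P o) - ∑ o, (v o : ℂ) * s (P o) := by
    rw [Fintype.sum_option, Fintype.sum_option, hv1]
    have : ∀ c, s (P (some c)) = f (P (some c)) := fun c => hs.eqOn (hYX c)
    simp only [this]
    simp [P]
  rw [hdiff]
  have hN := nativeNorm_nonneg (gaussianFn n β) f 0
  have h1 := (norm_sum_mul_le_nativeNorm_mul (continuous_gaussianFn n β) hf P
    fun o => (v o : ℂ)).trans (mul_le_mul_of_nonneg_left hsqrt hN)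
  have h2 := (hs.norm_sum_mul_le hβ hf P fun o => (v o : ℂ)).trans
    (mul_le_mul_of_nonneg_left hsqrt hN)
  refine (_root_.norm_sub_le _ _).trans ((add_le_add h1 h2).trans_eq ?_)
  ring

theorem theorem1 (n : ℕ) (hn : 1 ≤ n) (β : ℝ) (hβ : 0 < β) (b₀ : ℝ) (hb₀ : 0 < b₀) :
    0 < deltaZero n β b₀ ∧ 0 < smallC n b₀ ∧ 0 < bigC n β b₀ ∧
    ∀ f ∈ nativeSpace (gaussianFn n β) 0, ∀ (X : Set (RSpace n)) (s : RSpace n → ℂ),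
      IsSplineInterpolant (gaussianFn n β) 0 f X s →
      ∀ (u : OrthonormalBasis (Fin n) ℝ (RSpace n)) (a : RSpace n) (b δ : ℝ),
        b₀ ≤ b → 0 < δ → δ ≤ deltaZero n β b₀ →
        (∀ a' : RSpace n, cube u a' δ ⊆ cube u a b → (cube u a' δ ∩ X).Nonempty) →
        ∀ x ∈ cube u a b,
          ‖f x - s x‖ ≤ deltaConst n * (bigC n β b₀ * δ) ^ (smallC n b₀ / δ)
            * nativeNorm (gaussianFn n β) 0 f := by
  have hγ : (0 : ℝ) < gammaSeq n := by exact_mod_cast gammaSeq_pos hn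
  have hC := bigC_pos hn hβ hb₀
  refine ⟨?_, by rw [smallC]; positivity, hC, ?_⟩
  · rw [deltaZero_eq]
    exact lt_min (by positivity) (deltaN_pos hn hb₀)
  intro f hf X s hs u a b δ hb hδ hδ₀ hX x hx
  obtain ⟨k, hk, hkb, hsmall, hbound⟩ := exists_degree hn hβ hb₀ hδ hδ₀
  exact (hs.interpolationError_le hn hk hβ hδ (hkb.trans hb) hsmall hf u a hX hx).trans
    (mul_le_mul_of_nonneg_right hbound (nativeNorm_nonneg _ _ _))
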